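/- Let $p\ge 1$ be a fixed real number that is not an even integer. For an integer $L\ge 1$ let $$M_p(L)=\sup_{\pi_0,\pi_1}\Big(\int |v|^p\,d\pi_1(v)-\int |v|^p\,d\pi_0(v)\Big),$$ where the supremum is over all pairs of probability measures $\pi_0,\pi_1$ supported on $[-1,1]$ with $\int v^l\,d\pi_0=\int v^l\,d\pi_1$ for all integers $1\le l\le L$. (i) There are constants $C_p,C_p'>0$, depending only on $p$, such that for all integers $L\ge 1$ $$C_p\,L^{-p}\le M_p(L)\le C_p'\,L^{-p};$$ equivalently, $M_p(L)^{1/p}\asymp 1/L$, with constants depending only on $p$. (ii) Consider one observation $X\sim P_v=\mathcal N(v,\sigma^2 I_d)$ with unknown $v\in\mathbb R^d$ and known $\sigma\in(0,1]$, and the testing problem $H_0:\|v\|_p\le\epsilon_0$ versus $H_1:\|v\|_p\ge\epsilon_1$. Let $\alpha,\beta>0$ with $\alpha+\beta<1$. A test is a measurable map $\psi:\mathbb R^d\to\{0,1\}$; it is valid if $P_v(\psi(X)=1)\le\alpha$ for all $v$ with $\|v\|_p\le\epsilon_0$. Put $$R_*(\epsilon_0,\epsilon_1)=\inf_{\psi\text{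 valid}}\ \sup_{\|v\|_p\ge\epsilon_1}P_v(\psi(X)=0),\qquad \epsilon_1^*(\epsilon_0)-\epsilon_0=\inf\{\epsilon_1-\epsilon_0:\ \epsilon_1\ge\epsilon_0,\ R_*(\epsilon_0,\epsilon_1)<\beta\}.$$ Then $\epsilon_1^*(\epsilon_0)-\epsilon_0\gtrsim\epsilon_0$ whenever $\epsilon_0\asymp\sigma d^{1/p}/\sqrt{\log d}$. That is, for all $0<a\le b$ there are $c>0$ and $d_0$, depending only on $p,\alpha,\beta,a,b$, such that for all $d\ge d_0$, all $\sigma\in(0,1]$ and all $\epsilon_0$ with $a\,\sigma d^{1/p}/\sqrt{\log d}\le\epsilon_0\le b\,\sigma d^{1/p}/\sqrt{\log d}$, $$\epsilon_1^*(\epsilon_0)-\epsilon_0\ \ge\ c\,\epsilon_0 .$$ -/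

import Mathlib

open MeasureTheory ProbabilityTheory

noncomputable section

/-- The values `E_{v ∼ π₁} |v|^p - E_{v ∼ π₀} |v|^p`, where `π₀`, `π₁` range over the probability
measures on `ℝ` supported on `[-1, 1]` that share their first `L` moments. -/
def momentMatchingGaps (p : ℝ) (L : ℕ) : Set ℝ :=
  {r | ∃ π₀ π₁ : Measure ℝ, IsProbabilityMeasure π₀ ∧ IsProbabilityMeasure π₁ ∧
    π₀ (Set.Icc (-1) 1)ᶜ = 0 ∧ π₁ (Set.Icc (-1) 1)ᶜ = 0 ∧
    (∀ l : ℕ, 1 ≤ l → l ≤ L → ∫ v, v ^ l ∂π₀ = ∫ v, v ^ l ∂π₁) ∧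
    r = ∫ v, |v| ^ p ∂π₁ - ∫ v, |v| ^ p ∂π₀}

/-- The unconstrained moment-matching gap `M_p(L)`. -/
def momentMatchingGap (p : ℝ) (L : ℕ) : ℝ :=
  sSup (momentMatchingGaps p L)

theorem momentMatchingGaps_nonempty (p : ℝ) (L : ℕ) : (momentMatchingGaps p L).Nonempty :=
  ⟨0, Measure.dirac 0, Measure.dirac 0, inferInstance, inferInstance, by simp, by simp,
    fun _ _ _ => rfl, by simp⟩

theorem abs_rpow_integral_mem_Icc {p : ℝ} (hp : 0 ≤ p) (π : Measure ℝ) [IsProbabilityMeasure π]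
    (hπ : π (Set.Icc (-1) 1)ᶜ = 0) : ∫ v, |v| ^ p ∂π ∈ Set.Icc (0 : ℝ) 1 := by
  have hae : ∀ᵐ v ∂π, ‖|v| ^ p‖ ≤ (1 : ℝ) := by
    have h : ∀ᵐ v ∂π, v ∈ Set.Icc (-1 : ℝ) 1 := hπ
    filter_upwards [h] with v hv
    rw [Real.norm_of_nonneg (by positivity)]
    exact Real.rpow_le_one (abs_nonneg v) (abs_le.mpr hv) hp
  refine ⟨integral_nonneg fun v => by positivity, ?_⟩
  have h := norm_integral_le_of_norm_le_const hae
  simp only [probReal_univ, mul_one] at h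
  exact (le_abs_self _).trans h

theorem momentMatchingGaps_bddAbove {p : ℝ} (hp : 0 ≤ p) (L : ℕ) :
    BddAbove (momentMatchingGaps p L) := by
  refine ⟨1, ?_⟩
  rintro r ⟨π₀, π₁, h₀, h₁, hs₀, hs₁, -, rfl⟩
  have a₀ := (abs_rpow_integral_mem_Icc hp π₀ hs₀).1
  have a₁ := (abs_rpow_integral_mem_Icc hp π₁ hs₁).2
  linarith

/-- The `ℓ_p` norm on `ℝ^d`. -/
def lpNormVec (p : ℝ) {d : ℕ} (v : Fin d → ℝ) : ℝ :=
  ‖WithLp.toLp (ENNReal.ofReal p) v‖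

theorem lpNormVec_eq {p : ℝ} (hp : 0 < p) {d : ℕ} (v : Fin d → ℝ) :
    lpNormVec p v = (∑ i, |v i| ^ p) ^ (1 / p) := by
  have h : (ENNReal.ofReal p).toReal = p := ENNReal.toReal_ofReal hp.le
  rw [lpNormVec, PiLp.norm_eq_sum (by rw [h]; exact hp), h]
  rfl

/-- The law `P_v = N(v, σ² I_d)` of the Gaussian sequence model: independent coordinates, the
`i`-th one with law `N(v i, σ²)`. -/
def gaussianSequence {d : ℕ} (σ : ℝ) (v : Fin d → ℝ) : Measure (Fin d → ℝ) :=
  Measure.pi fun i => gaussianReal (v i) (Real.toNNReal (σ ^ 2))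

/-- A test is a measurable map from the sample space to `{0, 1}` (`true` rejects the null). It is
valid for `H₀ : ‖v‖_p ≤ ε₀` if its type-I error is at most `α` under the whole null. -/
structure IsValidTest (p α σ ε₀ : ℝ) {d : ℕ} (ψ : (Fin d → ℝ) → Bool) : Prop where
  measurable : Measurable ψ
  type_one_error : ∀ v : Fin d → ℝ, lpNormVec p v ≤ ε₀ →
    gaussianSequence σ v {x | ψ x = true} ≤ ENNReal.ofReal α

/-- The risk of a test: its largest type-II error over `H₁ : ‖v‖_p ≥ ε₁`. -/
def testRisk (p σ ε₁ : ℝ) {d : ℕ} (ψ : (Fin d → ℝ) → Bool) : ENNReal :=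
  ⨆ (v : Fin d → ℝ) (_ : ε₁ ≤ lpNormVec p v), gaussianSequence σ v {x | ψ x = false}

/-- The minimax risk `R_*(ε₀, ε₁)`: the smallest risk among the valid tests. -/
def minimaxRisk (p α σ ε₀ ε₁ : ℝ) (d : ℕ) : ENNReal :=
  ⨅ (ψ : (Fin d → ℝ) → Bool) (_ : IsValidTest p α σ ε₀ ψ), testRisk p σ ε₁ ψ

/-- The critical separation
`ε₁^*(ε₀) - ε₀ = inf {ε₁ - ε₀ : ε₁ ≥ ε₀ and R_*(ε₀, ε₁) < β}`. -/
def criticalSeparation (p α β σ ε₀ : ℝ) (d : ℕ) : ENNReal :=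
  ⨅ (ε₁ : ℝ) (_ : ε₀ ≤ ε₁ ∧ minimaxRisk p α σ ε₀ ε₁ d < ENNReal.ofReal β),
    ENNReal.ofReal (ε₁ - ε₀)

end

/-! Put v = sin θ. The cosine coefficients b_m of |sin θ|^p obey a two-term recurrence. Since p is
not an even integer, they never vanish; for m > p/2 they keep one sign s and are of order m^(-(p+1))
(`sinPowCoeff_asymp`).

Lower bound in (i) (`exists_moment_matching`): push forward by sin the densities K(θ)(1 ± s cos
2Mθ)/Z, where K is an even power of the Dirichlet kernel of order L and M is a multiple of L. The
frequencies of K cos 2Mθ are of order L and exceed those of sin^l for l ≤ L, so the moments agree.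
The gap is about L times an average of b_m over m ≍ L, hence of order L^(-p). As K concentrates
where |sin θ| ≲ 1/L, the p-th moment of π₀ is itself O(L^(-p)), which (ii) needs.

Upper bound in (i) (`exists_polynomial_approx_abs_rpow`): the truncated Fourier series is a
polynomial in sin θ of degree at most L, with error O(L^(-p)) because p b_m telescopes. Measures
sharing L moments integrate this polynomial equally.

For (ii), rescale such a pair to radius A = σ √(log d) with at least 16 log d matched moments, and
mix with a common point mass so that the p-th moments lie a constant factor apart around ε₀^p / d
(`exists_priors`). The one-coordinate Gaussian mixtures differ by at most 4/d² on [0,1]-valued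
functions (`lintegral_gaussianMixture_le`), so their d-fold products differ by at most 4/d. By
Chebyshev's inequality ∑ |v_i|^p concentrates, so the i.i.d. priors sit almost entirely in H₀ and in
{‖v‖_p ≥ (1+2η)^(1/p) ε₀}. A valid test of risk below β would then give 1 ≤ α + β + o(1)
(`one_le_of_priors`). -/

/-! ### Fourier coefficients of |sin|^p: recurrence, sign and size. -/

/-- The cosine coefficients `∫₀^π sin^p θ cos (2mθ) dθ` of `|sin|^p`. -/
noncomputable def sinPowCoeff (p : ℝ) (m : ℤ) : ℝ :=
  ∫ θ in (0 : ℝ)..Real.pi, Real.sin θ ^ p * Real.cos (2 * m * θ)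

theorem continuous_sin_rpow {p : ℝ} (hp : 0 ≤ p) : Continuous fun θ : ℝ => Real.sin θ ^ p :=
  Real.continuous_sin.rpow_const fun _ => Or.inr hp

theorem sinPowCoeff_neg (p : ℝ) (m : ℤ) : sinPowCoeff p (-m) = sinPowCoeff p m := by
  unfold sinPowCoeff
  congr 1
  ext θ
  rw [← Real.cos_neg (2 * m * θ)]
  push_cast
  ring_nf

theorem sinPowCoeff_zero_pos {p : ℝ} (hp : 0 ≤ p) : 0 < sinPowCoeff p 0 := by
  unfold sinPowCoeff
  refine intervalIntegral.intervalIntegral_pos_of_pos_on ?_ ?_ Real.pi_pos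
  · exact ((continuous_sin_rpow hp).mul (by fun_prop)).intervalIntegrable _ _
  · intro θ hθ
    have := Real.rpow_pos_of_pos (Real.sin_pos_of_pos_of_lt_pi hθ.1 hθ.2) p
    simpa using this

/-- The integrand on the left of the recurrence is the derivative of
`sin^(p+1) θ cos ((2m+1)θ)`. -/
theorem sinPowCoeff_succ {p : ℝ} (hp : 0 ≤ p) (m : ℤ) :
    (m + 1 + p / 2) * sinPowCoeff p (m + 1) = (m - p / 2) * sinPowCoeff p m := by
  have hderiv : ∀ θ ∈ Set.uIcc 0 Real.pi,
      HasDerivAt (fun θ : ℝ => Real.sin θ ^ (p + 1) * Real.cos ((2 * m + 1) * θ))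
        ((m + 1 + p / 2) * (Real.sin θ ^ p * Real.cos (2 * (m + 1 : ℤ) * θ)) -
          (m - p / 2) * (Real.sin θ ^ p * Real.cos (2 * m * θ))) θ := by
    intro θ hθ
    rw [Set.uIcc_of_le Real.pi_pos.le] at hθ
    have hs := Real.sin_nonneg_of_nonneg_of_le_pi hθ.1 hθ.2
    have h1 := (Real.hasDerivAt_sin θ).rpow_const (p := p + 1) (Or.inr (by linarith))
    have h2 : HasDerivAt (fun θ : ℝ => Real.cos ((2 * m + 1) * θ))
        (-Real.sin ((2 * m + 1) * θ) * (2 * m + 1)) θ := by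
      have := ((hasDerivAt_id θ).const_mul ((2 * m + 1 : ℝ))).cos
      simpa using this
    have h := h1.mul h2
    refine h.congr_deriv ?_
    have e1 : (2 * ((m + 1 : ℤ) : ℝ) * θ) = (2 * m + 1) * θ + θ := by push_cast; ring
    have e2 : (2 * (m : ℝ) * θ) = (2 * m + 1) * θ - θ := by ring
    rw [e1, e2, Real.cos_add, Real.cos_sub, add_sub_cancel_right,
      Real.rpow_add_of_nonneg hs hp zero_le_one, Real.rpow_one]
    ring
  have hc : ∀ k : ℤ, Continuous fun θ : ℝ => Real.sin θ ^ p * Real.cos (2 * k * θ) := fun k =>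
    (continuous_sin_rpow hp).mul (by fun_prop)
  have hi : ∀ (k : ℤ) (c : ℝ), IntervalIntegrable
      (fun θ : ℝ => c * (Real.sin θ ^ p * Real.cos (2 * k * θ))) volume 0 Real.pi := fun k c =>
    (continuous_const.mul (hc k)).intervalIntegrable _ _
  have h := intervalIntegral.integral_eq_sub_of_hasDerivAt hderiv ((hi _ _).sub (hi _ _))
  rw [intervalIntegral.integral_sub (hi _ _) (hi _ _), intervalIntegral.integral_const_mul,
    intervalIntegral.integral_const_mul] at h
  have h0 : (0 : ℝ) ^ (p + 1) = 0 := Real.zero_rpow (by linarith)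
  simp only [Real.sin_pi, Real.sin_zero, h0, zero_mul, sub_zero] at h
  unfold sinPowCoeff
  linarith

theorem sinPowCoeff_nat_succ {p : ℝ} (hp : 0 ≤ p) (m : ℕ) :
    (m + 1 + p / 2) * sinPowCoeff p ((m + 1 : ℕ) : ℤ) = (m - p / 2) * sinPowCoeff p m := by
  simpa using sinPowCoeff_succ hp m

/-- The recurrence can reach zero only through its factor `m - p / 2`; this is where even exponents
are excluded. -/
theorem sinPowCoeff_ne_zero {p : ℝ} (hp : 0 ≤ p) (hp_even : ∀ k : ℕ, p ≠ 2 * (k : ℝ)) (m : ℕ) :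
    sinPowCoeff p m ≠ 0 := by
  induction m with
  | zero => simpa using (sinPowCoeff_zero_pos hp).ne'
  | succ m ih =>
    intro h
    have := sinPowCoeff_nat_succ hp m
    rw [h, mul_zero, eq_comm, mul_eq_zero] at this
    rcases this with h' | h'
    · exact hp_even m (by linarith)
    · exact ih h'

/-- `p b_m` telescopes. -/
theorem sinPowCoeff_telescope {p : ℝ} (hp : 0 ≤ p) (m : ℕ) :
    p * sinPowCoeff p m = (m + p / 2) * sinPowCoeff p m -
      ((m + 1 : ℕ) + p / 2) * sinPowCoeff p ((m + 1 : ℕ) : ℤ) := by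
  have := sinPowCoeff_nat_succ hp m
  push_cast at this ⊢
  linarith

/-- Beyond p/2 the ratio (m - p/2)/(m + 1 + p/2) is positive, so the sign freezes. Bernoulli's
inequality makes e_m (m - p/2)^(p+1) nondecreasing and e_m (m + p/2)^(p+1) nonincreasing, because
the denominator of the ratio exceeds its numerator by exactly p + 1. -/
theorem sinPowCoeff_asymp {p : ℝ} (hp : 0 ≤ p) (hp_even : ∀ k : ℕ, p ≠ 2 * (k : ℝ)) :
    ∃ s : ℝ, (s = 1 ∨ s = -1) ∧ ∃ c C : ℝ, 0 < c ∧ 0 < C ∧ ∀ m : ℕ, p / 2 < m →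
      c * (m : ℝ) ^ (-(p + 1)) ≤ s * sinPowCoeff p m ∧
      s * sinPowCoeff p m ≤ C * (m : ℝ) ^ (-(p + 1)) := by
  set m₀ := ⌊p / 2⌋₊ + 1 with hm₀
  have hm₀p : p / 2 < m₀ := by rw [hm₀]; push_cast; exact Nat.lt_floor_add_one _
  obtain ⟨s, hs, hpos⟩ : ∃ s : ℝ, (s = 1 ∨ s = -1) ∧ 0 < s * sinPowCoeff p m₀ := by
    rcases lt_or_gt_of_ne (sinPowCoeff_ne_zero hp hp_even m₀) with h | h
    · exact ⟨-1, Or.inr rfl, by linarith⟩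
    · exact ⟨1, Or.inl rfl, by linarith⟩
  set e : ℕ → ℝ := fun m => s * sinPowCoeff p m with he
  have hrec : ∀ m : ℕ, e (m + 1) * (m + 1 + p / 2) = e m * (m - p / 2) := fun m => by
    have := sinPowCoeff_nat_succ hp m
    simp only [he]
    linear_combination s * this
  have key : ∀ m : ℕ, m₀ ≤ m → 0 < e m ∧
      e m₀ * (m₀ - p / 2) ^ (p + 1) ≤ e m * (m - p / 2) ^ (p + 1) ∧
      e m * (m + p / 2) ^ (p + 1) ≤ e m₀ * (m₀ + p / 2) ^ (p + 1) := by
    intro m hm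
    induction m, hm using Nat.le_induction with
    | base => exact ⟨hpos, le_rfl, le_rfl⟩
    | succ m hm ih =>
      obtain ⟨ih0, ih1, ih2⟩ := ih
      have hmm : (m₀ : ℝ) ≤ m := by exact_mod_cast hm
      have hz : 0 < (m : ℝ) - p / 2 := by linarith
      have hy : 0 < (m : ℝ) + 1 + p / 2 := by linarith
      have hee : e (m + 1) = e m * ((m - p / 2) / (m + 1 + p / 2)) := by
        rw [← mul_div_assoc, ← hrec m, mul_div_cancel_right₀ _ hy.ne']
      refine ⟨by rw [hee]; positivity, ih1.trans ?_, le_trans ?_ ih2⟩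
      · rw [hee, mul_assoc (e m)]
        refine mul_le_mul_of_nonneg_left ?_ ih0.le
        push_cast
        have hB := one_add_mul_self_le_rpow_one_add (s := 1 / ((m : ℝ) - p / 2))
          (by have : 0 < 1 / ((m : ℝ) - p / 2) := by positivity
              linarith) (p := p + 1) (by linarith)
        have e1 : (m : ℝ) + 1 - p / 2 = (m - p / 2) * (1 + 1 / ((m : ℝ) - p / 2)) := by
          rw [mul_add, mul_one_div_cancel hz.ne']; ring
        rw [e1, Real.mul_rpow hz.le (by positivity)]
        have e2 : ((m : ℝ) - p / 2) / (m + 1 + p / 2) * (1 + (p + 1) * (1 / ((m : ℝ) - p / 2))) = 1 := by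
          rw [div_mul_eq_mul_div, div_eq_one_iff_eq hy.ne', mul_add, mul_left_comm,
            mul_one_div_cancel hz.ne']
          ring
        have hq : 0 ≤ ((m : ℝ) - p / 2) / (m + 1 + p / 2) := by positivity
        have h3 := mul_le_mul_of_nonneg_left hB hq
        rw [e2] at h3
        have h4 := mul_le_mul_of_nonneg_left h3 (Real.rpow_nonneg hz.le (p + 1))
        linarith
      · rw [hee, mul_assoc (e m)]
        refine mul_le_mul_of_nonneg_left ?_ ih0.le
        push_cast
        have hB := one_add_mul_self_le_rpow_one_add (s := -(1 / ((m : ℝ) + 1 + p / 2)))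
          (by have : 1 / ((m : ℝ) + 1 + p / 2) ≤ 1 := by
                rw [div_le_one hy]; have := Nat.cast_nonneg (α := ℝ) m; linarith
              linarith) (p := p + 1) (by linarith)
        have hm0 : 0 ≤ (m : ℝ) + p / 2 := by positivity
        have e1 : 1 + -(1 / ((m : ℝ) + 1 + p / 2)) = (m + p / 2) / (m + 1 + p / 2) := by
          field_simp; ring
        have e2 : ((m : ℝ) - p / 2) / (m + 1 + p / 2) =
            1 + (p + 1) * -(1 / ((m : ℝ) + 1 + p / 2)) := by
          field_simp; ring
        rw [e1, ← e2, Real.div_rpow hm0 hy.le, le_div_iff₀ (Real.rpow_pos_of_pos hy _)] at hB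
        exact hB
  refine ⟨s, hs, e m₀ * (m₀ - p / 2) ^ (p + 1), e m₀ * (m₀ + p / 2) ^ (p + 1), ?_, ?_, ?_⟩
  · have : 0 < (m₀ : ℝ) - p / 2 := by linarith
    exact mul_pos hpos (Real.rpow_pos_of_pos this _)
  · have : 0 < (m₀ : ℝ) + p / 2 := by linarith
    exact mul_pos hpos (Real.rpow_pos_of_pos this _)
  intro m hm
  have hm' : m₀ ≤ m := by
    rw [hm₀]; exact Nat.succ_le_of_lt ((Nat.floor_lt (by linarith)).2 hm)
  obtain ⟨k0, k1, k2⟩ := key m hm'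
  have hmp : 0 < (m : ℝ) := by linarith
  have hmpow := Real.rpow_pos_of_pos hmp (p + 1)
  rw [Real.rpow_neg hmp.le, ← div_eq_mul_inv, ← div_eq_mul_inv, div_le_iff₀ hmpow,
    le_div_iff₀ hmpow]
  constructor
  · refine k1.trans (mul_le_mul_of_nonneg_left ?_ k0.le)
    exact Real.rpow_le_rpow (by linarith) (by linarith) (by linarith)
  · refine le_trans (mul_le_mul_of_nonneg_left ?_ k0.le) k2
    exact Real.rpow_le_rpow (by linarith) (by linarith) (by linarith)

/-! ### Orthogonality of powers of sine to high frequencies. -/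

theorem integral_cos_int_mul {k : ℤ} (hk : k ≠ 0) :
    ∫ θ in (0 : ℝ)..2 * Real.pi, Real.cos (k * θ) = 0 := by
  have hk' : (k : ℝ) ≠ 0 := by exact_mod_cast hk
  rw [intervalIntegral.integral_comp_mul_left (fun x => Real.cos x) hk', integral_cos,
    show (k : ℝ) * (2 * Real.pi) = ((k * 2 : ℤ) : ℝ) * Real.pi by push_cast; ring,
    Real.sin_int_mul_pi]
  simp

theorem integral_sin_int_mul (k : ℤ) :
    ∫ θ in (0 : ℝ)..2 * Real.pi, Real.sin (k * θ) = 0 := by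
  rcases eq_or_ne k 0 with rfl | hk
  · simp
  have hk' : (k : ℝ) ≠ 0 := by exact_mod_cast hk
  rw [intervalIntegral.integral_comp_mul_left (fun x => Real.sin x) hk', integral_sin,
    Real.cos_int_mul_two_pi]
  simp

/-- A factor sin θ shifts the frequency by ±1 and exchanges sine with cosine, so both statements go
through one induction. -/
theorem integral_sin_pow_mul_trig (l : ℕ) : ∀ k : ℤ, (l : ℤ) < |k| →
    ∫ θ in (0 : ℝ)..2 * Real.pi, Real.sin θ ^ l * Real.cos (k * θ) = 0 ∧
    ∫ θ in (0 : ℝ)..2 * Real.pi, Real.sin θ ^ l * Real.sin (k * θ) = 0 := by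
  induction l with
  | zero =>
    intro k hk
    have hk0 : k ≠ 0 := by rintro rfl; simp at hk
    simp [integral_cos_int_mul hk0, integral_sin_int_mul]
  | succ l ih =>
    intro k hk
    have h1 : (l : ℤ) < |k + 1| := by push_cast at hk; grind
    have h2 : (l : ℤ) < |k - 1| := by push_cast at hk; grind
    have hci : ∀ j : ℤ, IntervalIntegrable (fun θ : ℝ => 1 / 2 * (Real.sin θ ^ l * Real.cos (j * θ)))
      volume 0 (2 * Real.pi) := fun j => Continuous.intervalIntegrable (by fun_prop) _ _
    have hsi : ∀ j : ℤ, IntervalIntegrable (fun θ : ℝ => 1 / 2 * (Real.sin θ ^ l * Real.sin (j * θ)))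
      volume 0 (2 * Real.pi) := fun j => Continuous.intervalIntegrable (by fun_prop) _ _
    have e1 : ∀ θ : ℝ, ((k + 1 : ℤ) : ℝ) * θ = k * θ + θ := fun θ => by push_cast; ring
    have e2 : ∀ θ : ℝ, ((k - 1 : ℤ) : ℝ) * θ = k * θ - θ := fun θ => by push_cast; ring
    constructor
    · have : ∀ θ : ℝ, Real.sin θ ^ (l + 1) * Real.cos (k * θ) =
          1 / 2 * (Real.sin θ ^ l * Real.sin ((k + 1 : ℤ) * θ)) -
          1 / 2 * (Real.sin θ ^ l * Real.sin ((k - 1 : ℤ) * θ)) := fun θ => by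
        rw [e1, e2, Real.sin_add, Real.sin_sub]; ring
      simp_rw [this]
      rw [intervalIntegral.integral_sub (hsi _) (hsi _), intervalIntegral.integral_const_mul,
        intervalIntegral.integral_const_mul, (ih _ h1).2, (ih _ h2).2]
      simp
    · have : ∀ θ : ℝ, Real.sin θ ^ (l + 1) * Real.sin (k * θ) =
          1 / 2 * (Real.sin θ ^ l * Real.cos ((k - 1 : ℤ) * θ)) -
          1 / 2 * (Real.sin θ ^ l * Real.cos ((k + 1 : ℤ) * θ)) := fun θ => by
        rw [e1, e2, Real.cos_add, Real.cos_sub]; ring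
      simp_rw [this]
      rw [intervalIntegral.integral_sub (hci _) (hci _), intervalIntegral.integral_const_mul,
        intervalIntegral.integral_const_mul, (ih _ h1).1, (ih _ h2).1]
      simp

theorem integral_sin_pow_mul_cos {l : ℕ} {m : ℤ} (h : (l : ℤ) < 2 * |m|) :
    ∫ θ in (0 : ℝ)..2 * Real.pi, Real.sin θ ^ l * Real.cos (2 * m * θ) = 0 := by
  have := (integral_sin_pow_mul_trig l (2 * m) (by rw [abs_mul]; simpa using h)).1
  simpa using this

theorem integral_abs_sin_rpow_mul_cos {p : ℝ} (hp : 0 ≤ p) (m : ℤ) :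
    ∫ θ in (0 : ℝ)..2 * Real.pi, |Real.sin θ| ^ p * Real.cos (2 * m * θ) =
      2 * sinPowCoeff p m := by
  have hc : Continuous fun θ : ℝ => |Real.sin θ| ^ p * Real.cos (2 * m * θ) :=
    (Real.continuous_sin.abs.rpow_const fun _ => Or.inr hp).mul (by fun_prop)
  have h1 : ∫ θ in (0 : ℝ)..Real.pi, |Real.sin θ| ^ p * Real.cos (2 * m * θ) = sinPowCoeff p m := by
    refine intervalIntegral.integral_congr fun θ hθ => ?_
    rw [Set.uIcc_of_le Real.pi_pos.le] at hθ
    simp only [abs_of_nonneg (Real.sin_nonneg_of_nonneg_of_le_pi hθ.1 hθ.2)]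
  have h2 : ∫ θ in Real.pi..2 * Real.pi, |Real.sin θ| ^ p * Real.cos (2 * m * θ) =
      ∫ θ in (0 : ℝ)..Real.pi, |Real.sin θ| ^ p * Real.cos (2 * m * θ) := by
    have := intervalIntegral.integral_comp_add_right (a := 0) (b := Real.pi)
      (fun θ : ℝ => |Real.sin θ| ^ p * Real.cos (2 * m * θ)) Real.pi
    rw [zero_add, ← two_mul] at this
    rw [← this]
    refine intervalIntegral.integral_congr fun θ _ => ?_
    simp only [Real.sin_add_pi, abs_neg]
    rw [show 2 * (m : ℝ) * (θ + Real.pi) = 2 * m * θ + m * (2 * Real.pi) by ring,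
      Real.cos_add_int_mul_two_pi]
  rw [← intervalIntegral.integral_add_adjacent_intervals (hc.intervalIntegrable 0 Real.pi)
    (hc.intervalIntegrable _ _), h2, h1, two_mul]

/-! ### The Dirichlet kernel and its powers. -/

/-- The Dirichlet kernel `∑_{|j| ≤ n} cos (2jθ)`. -/
noncomputable def dirichletCos (n : ℕ) (θ : ℝ) : ℝ :=
  1 + ∑ j ∈ Finset.range n, 2 * Real.cos (2 * (j + 1) * θ)

@[fun_prop]
theorem continuous_dirichletCos (n : ℕ) : Continuous (dirichletCos n) := by
  unfold dirichletCos
  fun_prop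

theorem dirichletCos_succ (n : ℕ) (θ : ℝ) :
    dirichletCos (n + 1) θ = dirichletCos n θ + 2 * Real.cos (2 * (n + 1) * θ) := by
  simp only [dirichletCos, Finset.sum_range_succ]
  ring

/-- Hence |sin θ| times the kernel is at most 1 in absolute value: each kernel factor can absorb one
factor |sin θ|, which measures the concentration of the kernel near the zeros of sine. -/
theorem sin_mul_dirichletCos (n : ℕ) (θ : ℝ) :
    Real.sin θ * dirichletCos n θ = Real.sin ((2 * n + 1) * θ) := by
  induction n with
  | zero => simp [dirichletCos]
  | succ n ih =>
    rw [dirichletCos_succ, mul_add, ih]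
    push_cast
    rw [show (2 * (n : ℝ) + 1) * θ = 2 * (n + 1) * θ - θ by ring,
      show (2 * ((n : ℝ) + 1) + 1) * θ = 2 * (n + 1) * θ + θ by ring, Real.sin_sub, Real.sin_add]
    ring

theorem abs_dirichletCos_le (n : ℕ) (θ : ℝ) : |dirichletCos n θ| ≤ 2 * n + 1 := by
  induction n with
  | zero => simp [dirichletCos]
  | succ n ih =>
    rw [dirichletCos_succ]
    refine (abs_add_le _ _).trans ?_
    rw [abs_mul, abs_two]
    have := Real.abs_cos_le_one (2 * (n + 1) * θ)
    push_cast
    linarith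

theorem le_dirichletCos {n : ℕ} {θ : ℝ} (h0 : 0 ≤ θ) (h : 2 * n * θ ≤ 1) :
    n + 1 ≤ dirichletCos n θ := by
  have : ∑ j ∈ Finset.range n, (1 : ℝ) ≤ ∑ j ∈ Finset.range n, 2 * Real.cos (2 * (j + 1) * θ) := by
    refine Finset.sum_le_sum fun j hj => ?_
    have hj' : (j : ℝ) + 1 ≤ n := by exact_mod_cast Finset.mem_range.1 hj
    have h1 : 2 * ((j : ℝ) + 1) * θ ≤ 1 := by nlinarith
    have h2 : 0 ≤ 2 * ((j : ℝ) + 1) * θ := by positivity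
    have := Real.one_sub_sq_div_two_le_cos (x := 2 * ((j : ℝ) + 1) * θ)
    nlinarith
  simp only [Finset.sum_const, Finset.card_range, nsmul_eq_mul, mul_one] at this
  unfold dirichletCos
  linarith

theorem cos_mul_dirichletCos (M : ℤ) (n : ℕ) (θ : ℝ) :
    Real.cos (2 * M * θ) * dirichletCos n θ = Real.cos (2 * M * θ) +
      ∑ j ∈ Finset.range n, (Real.cos (2 * (M + (j + 1) : ℤ) * θ) +
        Real.cos (2 * (M - (j + 1) : ℤ) * θ)) := by
  rw [dirichletCos, mul_add, mul_one, Finset.mul_sum]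
  congr 1
  refine Finset.sum_congr rfl fun j _ => ?_
  push_cast
  rw [show 2 * ((M : ℝ) + (j + 1)) * θ = 2 * M * θ + 2 * (j + 1) * θ by ring,
    show 2 * ((M : ℝ) - (j + 1)) * θ = 2 * M * θ - 2 * (j + 1) * θ by ring,
    Real.cos_add, Real.cos_sub]
  ring

/-- Multiplying by a power of the Dirichlet kernel averages the Fourier coefficients with
nonnegative weights, over the frequencies reached by that power. -/
theorem le_integral_mul_cos_mul_dirichletCos_pow {h : ℝ → ℝ} (hh : Continuous h) (n R : ℕ) (B : ℝ) :
    ∀ M : ℤ, (∀ m : ℤ, |m - M| ≤ R * n →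
      B ≤ ∫ θ in (0 : ℝ)..2 * Real.pi, h θ * Real.cos (2 * m * θ)) →
    (2 * n + 1) ^ R * B ≤
      ∫ θ in (0 : ℝ)..2 * Real.pi, h θ * Real.cos (2 * M * θ) * dirichletCos n θ ^ R := by
  induction R with
  | zero => intro M hM; simpa using hM M (by simp)
  | succ R ih =>
    intro M hM
    have hi : ∀ m : ℤ, IntervalIntegrable
        (fun θ : ℝ => h θ * Real.cos (2 * m * θ) * dirichletCos n θ ^ R)
        volume 0 (2 * Real.pi) := fun m => Continuous.intervalIntegrable (by fun_prop) _ _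
    have hterm : ∀ m : ℤ, |m - M| ≤ n → (2 * n + 1) ^ R * B ≤
        ∫ θ in (0 : ℝ)..2 * Real.pi, h θ * Real.cos (2 * m * θ) * dirichletCos n θ ^ R := by
      intro m hm
      refine ih m fun k hk => hM k ?_
      have := abs_sub_le k m M
      push_cast
      linarith
    have e : ∀ θ : ℝ, h θ * Real.cos (2 * M * θ) * dirichletCos n θ ^ (R + 1) =
        h θ * Real.cos (2 * M * θ) * dirichletCos n θ ^ R + ∑ j ∈ Finset.range n,
          (h θ * Real.cos (2 * (M + (j + 1) : ℤ) * θ) * dirichletCos n θ ^ R +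
           h θ * Real.cos (2 * (M - (j + 1) : ℤ) * θ) * dirichletCos n θ ^ R) := by
      intro θ
      rw [pow_succ', ← mul_assoc, mul_assoc (h θ), cos_mul_dirichletCos]
      simp_rw [← add_mul, ← mul_add]
      rw [← Finset.sum_mul, ← Finset.mul_sum]
      ring
    simp_rw [e]
    rw [intervalIntegral.integral_add (hi _)
      (Continuous.intervalIntegrable (by fun_prop) _ _), intervalIntegral.integral_finsetSum
      fun j _ => (hi _).add (hi _)]
    have hsum : ∑ j ∈ Finset.range n, (2 * ((2 * (n : ℝ) + 1) ^ R * B)) ≤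
        ∑ j ∈ Finset.range n, ∫ θ in (0 : ℝ)..2 * Real.pi,
          (h θ * Real.cos (2 * (M + (j + 1) : ℤ) * θ) * dirichletCos n θ ^ R +
           h θ * Real.cos (2 * (M - (j + 1) : ℤ) * θ) * dirichletCos n θ ^ R) := by
      refine Finset.sum_le_sum fun j hj => ?_
      have hj' : (j : ℤ) + 1 ≤ n := by exact_mod_cast Finset.mem_range.1 hj
      rw [intervalIntegral.integral_add (hi _) (hi _), two_mul]
      refine add_le_add (hterm _ ?_) (hterm _ ?_)
      · rw [add_sub_cancel_left, abs_of_nonneg (by positivity)]; exact hj'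
      · rw [sub_sub_cancel_left, abs_neg, abs_of_nonneg (by positivity)]; exact hj'
    have h0 := hterm M (by simp)
    simp only [Finset.sum_const, Finset.card_range, nsmul_eq_mul] at hsum
    rw [pow_succ]
    linarith

/-- The averaging inequality with bound 0, applied to `h` and to `-h`. -/
theorem integral_mul_cos_mul_dirichletCos_pow_eq_zero {h : ℝ → ℝ} (hh : Continuous h) (n R : ℕ)
    (M : ℤ) (hM : ∀ m : ℤ, |m - M| ≤ R * n →
      ∫ θ in (0 : ℝ)..2 * Real.pi, h θ * Real.cos (2 * m * θ) = 0) :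
    ∫ θ in (0 : ℝ)..2 * Real.pi, h θ * Real.cos (2 * M * θ) * dirichletCos n θ ^ R = 0 := by
  have h1 := le_integral_mul_cos_mul_dirichletCos_pow hh n R 0 M fun m hm => (hM m hm).ge
  have h2 := le_integral_mul_cos_mul_dirichletCos_pow (h := fun θ => -h θ) hh.neg n R 0 M fun m hm => by
    simp only [neg_mul, intervalIntegral.integral_neg, hM m hm, neg_zero, le_refl]
  simp only [neg_mul, intervalIntegral.integral_neg] at h2
  linarith

theorem integral_dirichletCos_sq (n : ℕ) :
    ∫ θ in (0 : ℝ)..2 * Real.pi, dirichletCos n θ ^ 2 = 2 * Real.pi * (2 * n + 1) := by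
  induction n with
  | zero => simp [dirichletCos]
  | succ n ih =>
    -- The cross term integrates to zero: the frequencies within n of n + 1 miss 0. The constant 2
    -- left by the squared cosine supplies the increment 4π.
    have e : ∀ θ : ℝ, dirichletCos (n + 1) θ ^ 2 = dirichletCos n θ ^ 2 +
        4 * (1 * Real.cos (2 * (n + 1 : ℤ) * θ) * dirichletCos n θ ^ 1) +
        (2 + 2 * Real.cos ((4 * (n + 1) : ℤ) * θ)) := fun θ => by
      rw [dirichletCos_succ]
      push_cast
      rw [show 4 * ((n : ℝ) + 1) * θ = 2 * (2 * (n + 1) * θ) by ring, Real.cos_two_mul]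
      ring
    simp_rw [e]
    rw [intervalIntegral.integral_add (Continuous.intervalIntegrable (by fun_prop) _ _)
      (Continuous.intervalIntegrable (by fun_prop) _ _), intervalIntegral.integral_add
      (Continuous.intervalIntegrable (by fun_prop) _ _)
      (Continuous.intervalIntegrable (by fun_prop) _ _), ih,
      intervalIntegral.integral_add (Continuous.intervalIntegrable (by fun_prop) _ _)
      (Continuous.intervalIntegrable (by fun_prop) _ _),
      intervalIntegral.integral_const_mul, intervalIntegral.integral_const_mul,
      integral_cos_int_mul (by positivity),
      integral_mul_cos_mul_dirichletCos_pow_eq_zero continuous_const n 1 (n + 1)]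
    · simp only [intervalIntegral.integral_const, smul_eq_mul]
      push_cast
      ring
    · intro m hm
      have hm0 : 2 * m ≠ 0 := by
        rintro h
        obtain rfl : m = 0 := by omega
        rw [zero_sub, abs_neg, abs_of_nonneg (by positivity)] at hm
        push_cast at hm
        omega
      simpa using integral_cos_int_mul hm0

/-! ### Construction of moment-matching measures from densities on the circle. -/

theorem exists_isProbabilityMeasure_of_density {w : ℝ → ℝ} (hw : Continuous w)
    (hw0 : ∀ θ, 0 ≤ w θ) (hw1 : ∫ θ in (0 : ℝ)..2 * Real.pi, w θ = 1) :
    ∃ π : Measure ℝ, IsProbabilityMeasure π ∧ π (Set.Icc (-1) 1)ᶜ = 0 ∧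
      ∀ g : ℝ → ℝ, Continuous g →
        ∫ v, g v ∂π = ∫ θ in (0 : ℝ)..2 * Real.pi, g (Real.sin θ) * w θ := by
  have hpi : (0 : ℝ) ≤ 2 * Real.pi := by positivity
  have hwi : IntegrableOn w (Set.Ioc 0 (2 * Real.pi)) :=
    (intervalIntegrable_iff_integrableOn_Ioc_of_le hpi).1 (hw.intervalIntegrable _ _)
  set μ := (volume.restrict (Set.Ioc 0 (2 * Real.pi))).withDensity
    (fun θ => ENNReal.ofReal (w θ)) with hμ
  have hμ1 : IsProbabilityMeasure μ := by
    constructor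
    rw [hμ, withDensity_apply _ MeasurableSet.univ, Measure.restrict_univ,
      ← ofReal_integral_eq_lintegral_ofReal hwi (Filter.Eventually.of_forall hw0),
      ← intervalIntegral.integral_of_le hpi, hw1, ENNReal.ofReal_one]
  refine ⟨μ.map Real.sin, Measure.isProbabilityMeasure_map Real.measurable_sin.aemeasurable, ?_, ?_⟩
  · rw [Measure.map_apply Real.measurable_sin measurableSet_Icc.compl]
    convert! measure_empty (μ := μ)
    ext θ
    simp [Real.neg_one_le_sin, Real.sin_le_one]
  · intro g hg
    rw [integral_map Real.measurable_sin.aemeasurable hg.aestronglyMeasurable, hμ,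
      integral_withDensity_eq_integral_toReal_smul (by fun_prop)
        (Filter.Eventually.of_forall fun _ => ENNReal.ofReal_lt_top),
      intervalIntegral.integral_of_le hpi]
    refine integral_congr_ae (Filter.Eventually.of_forall fun θ => ?_)
    simp only [ENNReal.toReal_ofReal (hw0 θ), smul_eq_mul]
    ring

theorem integral_dirichletCos_pow_le (n q : ℕ) :
    ∫ θ in (0 : ℝ)..2 * Real.pi, dirichletCos n θ ^ (2 * (q + 1)) ≤
      2 * Real.pi * (2 * n + 1) ^ (2 * q + 1) := by
  have : ∫ θ in (0 : ℝ)..2 * Real.pi, dirichletCos n θ ^ (2 * (q + 1)) ≤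
      ∫ θ in (0 : ℝ)..2 * Real.pi, (2 * n + 1) ^ (2 * q) * dirichletCos n θ ^ 2 := by
    refine intervalIntegral.integral_mono_on (by positivity)
      (Continuous.intervalIntegrable (by fun_prop) _ _)
      (Continuous.intervalIntegrable (by fun_prop) _ _) fun θ _ => ?_
    rw [mul_add, mul_one, pow_add]
    refine mul_le_mul_of_nonneg_right ?_ (sq_nonneg _)
    rw [← (even_two_mul q).pow_abs]
    exact pow_le_pow_left₀ (abs_nonneg _) (abs_dirichletCos_le n θ) _
  refine this.trans_eq ?_
  rw [intervalIntegral.integral_const_mul, integral_dirichletCos_sq]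
  ring

/-- On [0, 1/(2n+1)] the kernel is at least half its maximum 2n + 1; this already gives the order of
the upper bound. -/
theorem le_integral_dirichletCos_pow {n : ℕ} (hn : 1 ≤ n) (q : ℕ) :
    ((2 * n + 1 : ℝ) / 2) ^ (2 * (q + 1)) / (2 * n + 1) ≤
      ∫ θ in (0 : ℝ)..2 * Real.pi, dirichletCos n θ ^ (2 * (q + 1)) := by
  have hn' : (1 : ℝ) ≤ n := by exact_mod_cast hn
  have hc : ∀ a b : ℝ, IntervalIntegrable (fun θ => dirichletCos n θ ^ (2 * (q + 1))) volume a b :=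
    fun a b => Continuous.intervalIntegrable (by fun_prop) _ _
  have hle : 1 / (2 * n + 1 : ℝ) ≤ 2 * Real.pi := by
    have h1 : 1 / (2 * n + 1 : ℝ) ≤ 1 := by
      rw [div_le_one (by positivity)]; linarith
    linarith [Real.pi_gt_three]
  have h0 : 0 ≤ 1 / (2 * n + 1 : ℝ) := by positivity
  have h1 : ∫ θ in (0 : ℝ)..1 / (2 * n + 1 : ℝ), ((2 * n + 1 : ℝ) / 2) ^ (2 * (q + 1)) ≤
      ∫ θ in (0 : ℝ)..1 / (2 * n + 1 : ℝ), dirichletCos n θ ^ (2 * (q + 1)) := by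
    refine intervalIntegral.integral_mono_on h0 (by simp) (hc _ _) fun θ hθ => ?_
    refine pow_le_pow_left₀ (by positivity) (le_trans (by linarith) (le_dirichletCos hθ.1 ?_)) _
    have := (le_div_iff₀ (by positivity)).1 hθ.2
    nlinarith [hθ.1]
  have h2 : ∫ θ in (0 : ℝ)..1 / (2 * n + 1 : ℝ), dirichletCos n θ ^ (2 * (q + 1)) ≤
      ∫ θ in (0 : ℝ)..2 * Real.pi, dirichletCos n θ ^ (2 * (q + 1)) :=
    intervalIntegral.integral_mono_interval le_rfl h0 hle
      (Filter.Eventually.of_forall fun θ => (even_two_mul _).pow_nonneg _) (hc _ _)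
  refine le_trans (le_of_eq ?_) (h1.trans h2)
  rw [intervalIntegral.integral_const, smul_eq_mul, sub_zero]
  ring

/-- Of the 2(q+1) kernel factors, p absorb |sin|^p, two are kept for the L² norm, and the others are
bounded by 2n + 1. -/
theorem integral_abs_sin_rpow_mul_dirichletCos_pow_le {p : ℝ} (hp : 0 ≤ p) {q : ℕ} (hq : p ≤ q)
    (n : ℕ) : ∫ θ in (0 : ℝ)..2 * Real.pi, |Real.sin θ| ^ p * dirichletCos n θ ^ (2 * (q + 1)) ≤
      2 * Real.pi * (2 * n + 1) ^ (2 * q + 1) * (2 * n + 1 : ℝ) ^ (-p) := by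
  have hN : (0 : ℝ) < 2 * n + 1 := by positivity
  have : ∫ θ in (0 : ℝ)..2 * Real.pi, |Real.sin θ| ^ p * dirichletCos n θ ^ (2 * (q + 1)) ≤
      ∫ θ in (0 : ℝ)..2 * Real.pi,
        ((2 * n + 1) ^ (2 * q) * (2 * n + 1 : ℝ) ^ (-p)) * dirichletCos n θ ^ 2 := by
    refine intervalIntegral.integral_mono_on (by positivity)
      (Continuous.intervalIntegrable ((Real.continuous_sin.abs.rpow_const fun _ => Or.inr hp).mul
        (by fun_prop)) _ _)
      (Continuous.intervalIntegrable (by fun_prop) _ _) fun θ _ => ?_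
    rw [mul_add 2 q, mul_one, pow_add, ← mul_assoc]
    refine mul_le_mul_of_nonneg_right ?_ (sq_nonneg _)
    rw [← (even_two_mul q).pow_abs]
    have hd := abs_nonneg (dirichletCos n θ)
    have hs : |Real.sin θ| * |dirichletCos n θ| ≤ 1 := by
      rw [← abs_mul, sin_mul_dirichletCos]; exact Real.abs_sin_le_one _
    have hq2 : 0 ≤ ((2 * q : ℕ) : ℝ) - p := by push_cast; linarith
    have e : ∀ x : ℝ, 0 ≤ x → x ^ (2 * q) = x ^ p * x ^ (((2 * q : ℕ) : ℝ) - p) := fun x hx => by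
      rw [← Real.rpow_add_of_nonneg hx hp hq2, add_sub_cancel, Real.rpow_natCast]
    have eN : (2 * n + 1 : ℝ) ^ (2 * q) * (2 * n + 1 : ℝ) ^ (-p) =
        (2 * n + 1 : ℝ) ^ (((2 * q : ℕ) : ℝ) - p) := by
      rw [← Real.rpow_natCast, ← Real.rpow_add hN, sub_eq_add_neg]
    rw [e _ hd, ← mul_assoc, ← Real.mul_rpow (abs_nonneg _) hd, eN]
    calc _ ≤ 1 * |dirichletCos n θ| ^ (((2 * q : ℕ) : ℝ) - p) := by
          refine mul_le_mul_of_nonneg_right ?_ (Real.rpow_nonneg hd _)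
          exact Real.rpow_le_one (by positivity) hs hp
      _ ≤ _ := by
          rw [one_mul]
          exact Real.rpow_le_rpow hd (abs_dirichletCos_le n θ) hq2
  refine this.trans_eq ?_
  rw [intervalIntegral.integral_const_mul, integral_dirichletCos_sq]
  ring

/-- Moment-matching pairs with a gap of order `L^(-p)` in the `p`-th absolute moment, which
itself is of order `L^(-p)`. -/
theorem exists_moment_matching {p : ℝ} (hp : 1 ≤ p) (hp_even : ∀ k : ℕ, p ≠ 2 * (k : ℝ)) :
    ∃ c C : ℝ, 0 < c ∧ 0 < C ∧ ∀ L : ℕ, 1 ≤ L → ∃ π₀ π₁ : Measure ℝ,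
      IsProbabilityMeasure π₀ ∧ IsProbabilityMeasure π₁ ∧
      π₀ (Set.Icc (-1) 1)ᶜ = 0 ∧ π₁ (Set.Icc (-1) 1)ᶜ = 0 ∧
      (∀ l : ℕ, l ≤ L → ∫ v, v ^ l ∂π₀ = ∫ v, v ^ l ∂π₁) ∧
      ∫ v, |v| ^ p ∂π₀ ≤ C * (L : ℝ) ^ (-p) ∧
      c * (L : ℝ) ^ (-p) ≤ ∫ v, |v| ^ p ∂π₁ - ∫ v, |v| ^ p ∂π₀ := by
  have hp0 : 0 ≤ p := by linarith
  obtain ⟨s, hs, c₀, _, hc₀, -, hcoef⟩ := sinPowCoeff_asymp hp0 hp_even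
  set q := ⌈p⌉₊
  have hq : p ≤ q := Nat.le_ceil p
  -- An even power keeps K nonnegative, and 2q ≥ p leaves enough factors to absorb |sin|^p.
  set R := 2 * (q + 1) with hR
  set T : ℝ := 2 * R + 1 + q with hT
  have hTpos : 0 < T := by positivity
  refine ⟨4 * c₀ / Real.pi * T ^ (-(p + 1)), 2 * Real.pi * 2 ^ R, by positivity, by positivity, ?_⟩
  intro L hL
  have hL1 : (1 : ℝ) ≤ L := by exact_mod_cast hL
  have hL0 : (0 : ℝ) < L := by linarith
  set N : ℝ := 2 * L + 1 with hN
  have hN0 : 0 < N := by positivity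
  -- The frequencies M ± RL run from (1+q)L, beyond both L/2 and p/2, up to TL. The lower end gives
  -- the vanishing moments and the sign of the coefficients, the upper end their size.
  set M : ℤ := (R + 1 + q) * L with hM
  set K : ℝ → ℝ := fun θ => dirichletCos L θ ^ R with hK
  have hKc : Continuous K := by fun_prop
  have hK0 : ∀ θ, 0 ≤ K θ := fun θ => (even_two_mul _).pow_nonneg _
  set Z := ∫ θ in (0 : ℝ)..2 * Real.pi, K θ with hZ
  have hZle : Z ≤ 2 * Real.pi * N ^ (2 * q + 1) := integral_dirichletCos_pow_le L q
  have hZge : (N / 2) ^ R / N ≤ Z := le_integral_dirichletCos_pow hL q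
  have hZ0 : 0 < Z := lt_of_lt_of_le (by positivity) hZge
  have hrange : ∀ m : ℤ, |m - M| ≤ R * L → ((1 + q) * L : ℤ) ≤ m ∧ m ≤ (2 * R + 1 + q) * L := by
    intro m hm
    rw [abs_le] at hm
    constructor <;> linarith [hm.1, hm.2]
  have hvan : ∀ l : ℕ, l ≤ L →
      ∫ θ in (0 : ℝ)..2 * Real.pi, Real.sin θ ^ l * Real.cos (2 * M * θ) * K θ = 0 := by
    intro l hl
    refine integral_mul_cos_mul_dirichletCos_pow_eq_zero (by fun_prop) L R M fun m hm => ?_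
    refine integral_sin_pow_mul_cos ?_
    have h1 := (hrange m hm).1
    have h2 : (L : ℤ) ≤ (1 + q) * L := by nlinarith [(Nat.cast_nonneg q : (0 : ℤ) ≤ q), (Nat.cast_nonneg L : (0 : ℤ) ≤ L)]
    have h3 := le_abs_self m
    have h4 : (l : ℤ) ≤ L := by exact_mod_cast hl
    have h5 : (1 : ℤ) ≤ L := by exact_mod_cast hL
    linarith
  have hpc : Continuous fun θ : ℝ => |Real.sin θ| ^ p :=
    Real.continuous_sin.abs.rpow_const fun _ => Or.inr hp0
  set G := ∫ θ in (0 : ℝ)..2 * Real.pi, s * |Real.sin θ| ^ p * Real.cos (2 * M * θ) * K θ with hG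
  -- The R-th power of the kernel has 2L + 1 unit weights per factor, hence total weight N^R; each
  -- coefficient met is at least its bound at the largest frequency TL.
  have hGge : N ^ R * (2 * (c₀ * (T * L) ^ (-(p + 1)))) ≤ G := by
    refine le_integral_mul_cos_mul_dirichletCos_pow (continuous_const.mul hpc) L R _ M
      fun m hm => ?_
    obtain ⟨h1, h2⟩ := hrange m hm
    have hm0 : 0 ≤ m := le_trans (by positivity) h1
    lift m to ℕ using hm0
    have hsm : ∫ θ in (0 : ℝ)..2 * Real.pi,
        s * |Real.sin θ| ^ p * Real.cos (2 * (m : ℤ) * θ) =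
        s * ∫ θ in (0 : ℝ)..2 * Real.pi, |Real.sin θ| ^ p * Real.cos (2 * (m : ℤ) * θ) := by
      rw [← intervalIntegral.integral_const_mul]
      simp only [mul_assoc]
    refine le_trans ?_ hsm.ge
    rw [integral_abs_sin_rpow_mul_cos hp0, mul_left_comm s]
    have h1' : (1 + q : ℝ) * L ≤ m := by exact_mod_cast h1
    have h2' : (m : ℝ) ≤ T * L := by rw [hT]; exact_mod_cast h2
    have hmp : 1 + (q : ℝ) ≤ m := by nlinarith [(Nat.cast_nonneg q : (0 : ℝ) ≤ q)]
    refine mul_le_mul_of_nonneg_left (le_trans ?_ (hcoef m (by linarith)).1) (by norm_num)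
    refine mul_le_mul_of_nonneg_left ?_ hc₀.le
    exact Real.rpow_le_rpow_of_nonpos (by linarith) h2' (by linarith)
  have hG0 : 0 ≤ G := le_trans (by positivity) hGge
  have hscos : ∀ (t θ : ℝ), |t| = 1 → 0 ≤ 1 + t * Real.cos (2 * M * θ) := by
    intro t θ ht
    have h1 : |t * Real.cos (2 * M * θ)| ≤ 1 := by
      rw [abs_mul, ht, one_mul]; exact Real.abs_cos_le_one _
    linarith [(abs_le.1 h1).1]
  have hmeas : ∀ t : ℝ, |t| = 1 → ∃ π : Measure ℝ, IsProbabilityMeasure π ∧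
      π (Set.Icc (-1) 1)ᶜ = 0 ∧ ∀ g : ℝ → ℝ, Continuous g → ∫ v, g v ∂π =
        ((∫ θ in (0 : ℝ)..2 * Real.pi, g (Real.sin θ) * K θ) +
          t * ∫ θ in (0 : ℝ)..2 * Real.pi, g (Real.sin θ) * Real.cos (2 * M * θ) * K θ) / Z := by
    intro t ht
    have hint : ∀ g : ℝ → ℝ, Continuous g → ∫ θ in (0 : ℝ)..2 * Real.pi,
        g (Real.sin θ) * (K θ * (1 + t * Real.cos (2 * M * θ)) / Z) =
        ((∫ θ in (0 : ℝ)..2 * Real.pi, g (Real.sin θ) * K θ) +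
          t * ∫ θ in (0 : ℝ)..2 * Real.pi, g (Real.sin θ) * Real.cos (2 * M * θ) * K θ) / Z := by
      intro g hg
      rw [← intervalIntegral.integral_const_mul, ← intervalIntegral.integral_add
        (Continuous.intervalIntegrable (by fun_prop) _ _)
        (Continuous.intervalIntegrable (by fun_prop) _ _), ← intervalIntegral.integral_div]
      congr 1
      ext θ
      ring
    obtain ⟨π, h1, h2, h3⟩ := exists_isProbabilityMeasure_of_density
      (w := fun θ => K θ * (1 + t * Real.cos (2 * M * θ)) / Z) (by fun_prop)
      (fun θ => div_nonneg (mul_nonneg (hK0 θ) (hscos t θ ht)) hZ0.le) (by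
        have h := hint (fun _ => 1) continuous_const
        -- The zeroth moment is among the vanishing ones, so the perturbation leaves the total mass
        -- equal to 1.
        have h0 := hvan 0 (Nat.zero_le _)
        simp only [pow_zero] at h0
        simp only [one_mul] at h ⊢
        simp only [one_mul] at h0
        rw [h, h0, mul_zero, add_zero, ← hZ, div_self hZ0.ne'])
    exact ⟨π, h1, h2, fun g hg => (h3 g hg).trans (hint g hg)⟩
  have hs1 : |s| = 1 := by rcases hs with rfl | rfl <;> simp
  obtain ⟨π₀, a1, a2, a3⟩ := hmeas (-s) (by rw [abs_neg, hs1])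
  obtain ⟨π₁, b1, b2, b3⟩ := hmeas s hs1
  have hac : Continuous fun v : ℝ => |v| ^ p := continuous_abs.rpow_const fun _ => Or.inr hp0
  have hGs : G = s * ∫ θ in (0 : ℝ)..2 * Real.pi,
      |Real.sin θ| ^ p * Real.cos (2 * M * θ) * K θ := by
    rw [hG, ← intervalIntegral.integral_const_mul]
    simp only [mul_assoc]
  refine ⟨π₀, π₁, a1, b1, a2, b2, fun l hl => ?_, ?_, ?_⟩
  · rw [a3 _ (continuous_pow l), b3 _ (continuous_pow l), hvan l hl]
    simp
  -- For π₀ the term G ≥ 0 enters with a minus sign and can be dropped.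
  · rw [a3 _ hac, neg_mul, ← hGs, div_le_iff₀ hZ0]
    have h1 := integral_abs_sin_rpow_mul_dirichletCos_pow_le hp0 hq L
    have h2 : N ^ (-p) ≤ (L : ℝ) ^ (-p) :=
      Real.rpow_le_rpow_of_nonpos hL0 (by linarith) (by linarith)
    calc _ ≤ 2 * Real.pi * N ^ (2 * q + 1) * N ^ (-p) := by linarith
      _ ≤ 2 * Real.pi * N ^ (2 * q + 1) * (L : ℝ) ^ (-p) := by gcongr
      _ = 2 * Real.pi * 2 ^ R * (L : ℝ) ^ (-p) * ((N / 2) ^ R / N) := by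
          rw [div_pow, hR, show 2 * (q + 1) = (2 * q + 1) + 1 by ring, pow_succ N]
          field_simp
          ring
      _ ≤ _ := by gcongr
  · rw [a3 _ hac, b3 _ hac, neg_mul, ← hGs, ← sub_div, le_div_iff₀ hZ0]
    have hLp : (L : ℝ) ^ (-(p + 1)) * L = (L : ℝ) ^ (-p) := by
      rw [show -(p + 1) = -p - 1 by ring, Real.rpow_sub_one hL0.ne', div_mul_cancel₀ _ hL0.ne']
    calc _ ≤ 4 * c₀ / Real.pi * T ^ (-(p + 1)) * (L : ℝ) ^ (-p) *
          (2 * Real.pi * N ^ (2 * q + 1)) := by gcongr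
      _ = N ^ (2 * q + 1) * (2 * L) * (4 * c₀ * (T ^ (-(p + 1)) * (L : ℝ) ^ (-(p + 1)))) := by
          rw [← hLp]; field_simp
      _ ≤ N ^ (2 * q + 1) * N * (4 * c₀ * (T ^ (-(p + 1)) * (L : ℝ) ^ (-(p + 1)))) := by
          gcongr; linarith
      _ = 2 * (N ^ R * (2 * (c₀ * (T * L) ^ (-(p + 1))))) := by
          rw [Real.mul_rpow hTpos.le hL0.le, hR, show 2 * (q + 1) = (2 * q + 1) + 1 by ring,
            pow_succ N]
          ring
      _ ≤ 2 * G := by gcongr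
      _ = _ := by ring

/-! ### Upper bound on the gap: polynomial approximation of |x|^p. -/

/-- The sum telescopes and the last term, having the right sign, is dropped. This gives both
summability and a tail of order m b_m. -/
theorem sum_range_sinPowCoeff_le {p : ℝ} (hp : 0 < p) {s : ℝ}
    (hs : ∀ m : ℕ, p / 2 < m → 0 ≤ s * sinPowCoeff p m) {m : ℕ} (hm : p / 2 < m) (k : ℕ) :
    ∑ i ∈ Finset.range k, s * sinPowCoeff p ((i + m : ℕ) : ℤ) ≤
      (m + p / 2) * (s * sinPowCoeff p m) / p := by
  have key : p * ∑ i ∈ Finset.range k, s * sinPowCoeff p ((i + m : ℕ) : ℤ) =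
      (m + p / 2) * (s * sinPowCoeff p m) -
        ((k + m : ℕ) + p / 2) * (s * sinPowCoeff p ((k + m : ℕ) : ℤ)) := by
    induction k with
    | zero => simp
    | succ k ih =>
      rw [Finset.sum_range_succ, mul_add, ih]
      have := sinPowCoeff_telescope hp.le (k + m)
      rw [show k + 1 + m = k + m + 1 by ring]
      linear_combination s * this
  rw [le_div_iff₀ hp, mul_comm, key]
  have hkm : (m : ℝ) ≤ (k + m : ℕ) := by push_cast; linarith [Nat.cast_nonneg (α := ℝ) k]
  have := hs (k + m) (by linarith)
  have : 0 ≤ ((k + m : ℕ) + p / 2) * (s * sinPowCoeff p ((k + m : ℕ) : ℤ)) :=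
    mul_nonneg (by positivity) this
  linarith

/-- The integrand is odd under θ ↦ π - θ; hence the Fourier coefficients below are real. -/
theorem integral_sin_rpow_mul_sin (p : ℝ) (m : ℤ) :
    ∫ θ in (0 : ℝ)..Real.pi, Real.sin θ ^ p * Real.sin (2 * m * θ) = 0 := by
  have h := intervalIntegral.integral_comp_sub_left (a := 0) (b := Real.pi)
    (fun θ => Real.sin θ ^ p * Real.sin (2 * m * θ)) Real.pi
  rw [sub_self, sub_zero] at h
  have e : ∀ θ : ℝ, Real.sin (Real.pi - θ) ^ p * Real.sin (2 * m * (Real.pi - θ)) =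
      -(Real.sin θ ^ p * Real.sin (2 * m * θ)) := fun θ => by
    rw [Real.sin_pi_sub, show 2 * (m : ℝ) * (Real.pi - θ) = -(2 * m * θ) + m * (2 * Real.pi) by ring,
      Real.sin_add_int_mul_two_pi, Real.sin_neg, mul_neg]
  simp_rw [e, intervalIntegral.integral_neg] at h
  linarith

/-- The Fourier series of `|sin|^p`. -/
theorem hasSum_abs_sin_rpow {p : ℝ} (hp : 0 < p) (hsum : Summable fun n : ℤ => sinPowCoeff p n)
    (θ : ℝ) :
    HasSum (fun n : ℤ => sinPowCoeff p n / Real.pi * Real.cos (2 * n * θ)) (|Real.sin θ| ^ p) := by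
  have : Fact (0 < Real.pi) := ⟨Real.pi_pos⟩
  have hper : Function.Periodic (fun θ : ℝ => ((|Real.sin θ| ^ p : ℝ) : ℂ)) Real.pi := fun θ => by
    simp only [Real.sin_add_pi, abs_neg]
  have hcont : Continuous fun θ : ℝ => |Real.sin θ| ^ p :=
    Real.continuous_sin.abs.rpow_const fun _ => Or.inr hp.le
  let f : C(AddCircle Real.pi, ℂ) :=
    ⟨hper.lift, continuous_coinduced_dom.mpr (Complex.continuous_ofReal.comp hcont)⟩
  have hf : ∀ θ : ℝ, f (θ : AddCircle Real.pi) = ((|Real.sin θ| ^ p : ℝ) : ℂ) := fun θ => rfl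
  have hfour : ∀ (n : ℤ) (x : ℝ), fourier n (x : AddCircle Real.pi) =
      (Real.cos (2 * n * x) : ℂ) + (Real.sin (2 * n * x) : ℂ) * Complex.I := fun n x => by
    rw [fourier_coe_apply, show 2 * (Real.pi : ℂ) * Complex.I * n * x / Real.pi =
      ((2 * n * x : ℝ) : ℂ) * Complex.I by
        have : (Real.pi : ℂ) ≠ 0 := by exact_mod_cast Real.pi_ne_zero
        push_cast; field_simp, Complex.exp_mul_I, Complex.ofReal_cos, Complex.ofReal_sin]
  have hcoef : ∀ n : ℤ, fourierCoeff f n = ((sinPowCoeff p n / Real.pi : ℝ) : ℂ) := by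
    intro n
    rw [fourierCoeff_eq_intervalIntegral _ n 0, zero_add]
    have e : ∫ x in (0 : ℝ)..Real.pi, fourier (-n) (x : AddCircle Real.pi) • f x =
        ∫ x in (0 : ℝ)..Real.pi, (((Real.sin x ^ p * Real.cos (2 * n * x) : ℝ) : ℂ) -
          ((Real.sin x ^ p * Real.sin (2 * n * x) : ℝ) : ℂ) * Complex.I) := by
      refine intervalIntegral.integral_congr fun x hx => ?_
      rw [Set.uIcc_of_le Real.pi_pos.le] at hx
      simp only [hf, hfour, smul_eq_mul,
        abs_of_nonneg (Real.sin_nonneg_of_nonneg_of_le_pi hx.1 hx.2)]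
      push_cast
      rw [show 2 * -(n : ℂ) * x = -(2 * n * x) by ring, Complex.cos_neg, Complex.sin_neg]
      ring
    have hc : Continuous fun x : ℝ => Real.sin x ^ p := continuous_sin_rpow hp.le
    rw [e, intervalIntegral.integral_sub
      (Continuous.intervalIntegrable (by fun_prop) _ _)
      (Continuous.intervalIntegrable (by fun_prop) _ _), intervalIntegral.integral_mul_const,
      intervalIntegral.integral_ofReal, intervalIntegral.integral_ofReal,
      integral_sin_rpow_mul_sin]
    simp only [sinPowCoeff, Complex.ofReal_zero, zero_mul, sub_zero, Complex.real_smul]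
    push_cast
    ring
  have hs : Summable (fourierCoeff f) := by
    rw [show fourierCoeff f = fun n => ((sinPowCoeff p n / Real.pi : ℝ) : ℂ) from funext hcoef]
    exact Complex.summable_ofReal.2 (hsum.div_const _)
  have h := Complex.reCLM.hasSum (has_pointwise_sum_fourier_series_of_summable hs θ)
  rw [hf] at h
  convert h using 1
  · ext n
    simp only [hcoef, hfour, Complex.reCLM_apply, smul_eq_mul, Complex.re_ofReal_mul,
      Complex.add_re, Complex.ofReal_re, Complex.mul_I_re, Complex.ofReal_im, neg_zero, add_zero]
  · rw [Complex.reCLM_apply, Complex.ofReal_re]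

/-- Turns partial cosine sums with even frequencies into polynomials in sin θ. -/
theorem eval_chebyshev_sin (n : ℕ) (θ : ℝ) :
    (Polynomial.Chebyshev.T ℝ (2 * n)).eval (Real.sin θ) = (-1) ^ n * Real.cos (2 * n * θ) := by
  rw [← Real.cos_pi_div_two_sub, Polynomial.Chebyshev.T_real_cos]
  push_cast
  rw [show 2 * (n : ℝ) * (Real.pi / 2 - θ) = n * Real.pi - 2 * n * θ by ring,
    Real.cos_nat_mul_pi_sub]

theorem exists_polynomial_approx_abs_rpow {p : ℝ} (hp : 0 < p)
    (hp_even : ∀ k : ℕ, p ≠ 2 * (k : ℝ)) :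
    ∃ C : ℝ, 0 < C ∧ ∀ L : ℕ, 1 ≤ L → p ≤ L → ∃ P : Polynomial ℝ, P.natDegree ≤ L ∧
      ∀ x ∈ Set.Icc (-1 : ℝ) 1, |(|x| ^ p - P.eval x)| ≤ C * (L : ℝ) ^ (-p) := by
  obtain ⟨s, hs, c₀, C₀, hc₀, hC₀, hcoef⟩ := sinPowCoeff_asymp hp.le hp_even
  have hs1 : |s| = 1 := by rcases hs with rfl | rfl <;> simp
  have hpos : ∀ m : ℕ, p / 2 < m → 0 ≤ s * sinPowCoeff p m := fun m hm =>
    le_trans (by positivity) (hcoef m hm).1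
  have habs : ∀ m : ℕ, p / 2 < m → |sinPowCoeff p m| = s * sinPowCoeff p m := fun m hm => by
    rw [← abs_of_nonneg (hpos m hm), abs_mul, hs1, one_mul]
  have hsumtail : ∀ m : ℕ, p / 2 < m →
      Summable fun i : ℕ => s * sinPowCoeff p ((i + m : ℕ) : ℤ) := by
    intro m hm
    refine summable_of_sum_range_le (fun i => hpos _ ?_) (sum_range_sinPowCoeff_le hp hpos hm)
    push_cast
    linarith [Nat.cast_nonneg (α := ℝ) i]
  have hsumN : Summable fun n : ℕ => sinPowCoeff p n := by
    obtain ⟨m, hm⟩ := exists_nat_gt (p / 2)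
    rw [← summable_nat_add_iff m]
    have := (hsumtail m hm).mul_left s
    refine this.congr fun i => ?_
    rw [← mul_assoc, ← abs_mul_abs_self s, hs1]
    simp
  have hsumZ : Summable fun n : ℤ => sinPowCoeff p n :=
    Summable.of_nat_of_neg hsumN (by simpa only [sinPowCoeff_neg] using hsumN)
  -- Folding n with -n counts the zero frequency twice, whence the extra constant in `hhas`.
  set a : ℕ → ℝ → ℝ := fun n θ => 2 / Real.pi * sinPowCoeff p n * Real.cos (2 * n * θ) with ha
  have hhas : ∀ θ : ℝ, HasSum (fun n => a n θ) (|Real.sin θ| ^ p + sinPowCoeff p 0 / Real.pi) := by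
    intro θ
    have h := (hasSum_abs_sin_rpow hp hsumZ θ).nat_add_neg
    simp only [sinPowCoeff_neg, Int.cast_zero, mul_zero, zero_mul, Real.cos_zero, mul_one] at h
    refine h.congr_fun ?_
    intro n
    simp only [ha]
    push_cast
    rw [show 2 * -(n : ℝ) * θ = -(2 * n * θ) by ring, Real.cos_neg]
    ring
  refine ⟨2 / Real.pi * (2 * C₀ / p) * 2 ^ p, by positivity, fun L hL hpL => ?_⟩
  -- The degree 2N is at most L, and the first omitted index N + 1 exceeds L/2 ≥ p/2, so the tail
  -- has constant sign.
  set N := L / 2 with hN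
  have hNL : 2 * N ≤ L := by omega
  have hL0 : (0 : ℝ) < L := by exact_mod_cast hL
  have hLN : (L : ℝ) / 2 ≤ (N + 1 : ℕ) := by
    rw [div_le_iff₀ two_pos]
    exact_mod_cast (by omega : L ≤ (N + 1) * 2)
  have hmN : p / 2 < (N + 1 : ℕ) := by
    have : (L : ℝ) < (N + 1 : ℕ) * 2 := by exact_mod_cast (by omega : L < (N + 1) * 2)
    linarith
  refine ⟨∑ n ∈ Finset.range (N + 1), Polynomial.C (2 / Real.pi * sinPowCoeff p n * (-1) ^ n) *
    Polynomial.Chebyshev.T ℝ (2 * n) - Polynomial.C (sinPowCoeff p 0 / Real.pi), ?_, ?_⟩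
  · refine (Polynomial.natDegree_sub_le _ _).trans (max_le ?_ (by simp))
    refine Polynomial.natDegree_sum_le_of_forall_le _ _ fun n hn => ?_
    refine (Polynomial.natDegree_C_mul_le _ _).trans ?_
    rw [Polynomial.Chebyshev.natDegree_T]
    have := Finset.mem_range.1 hn
    omega
  · intro x hx
    obtain ⟨θ, rfl⟩ : ∃ θ, x = Real.sin θ := ⟨Real.arcsin x, (Real.sin_arcsin hx.1 hx.2).symm⟩
    have heval : (∑ n ∈ Finset.range (N + 1),
        Polynomial.C (2 / Real.pi * sinPowCoeff p n * (-1) ^ n) *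
        Polynomial.Chebyshev.T ℝ (2 * n) - Polynomial.C (sinPowCoeff p 0 / Real.pi)).eval
          (Real.sin θ) = ∑ n ∈ Finset.range (N + 1), a n θ - sinPowCoeff p 0 / Real.pi := by
      simp only [Polynomial.eval_sub, Polynomial.eval_finsetSum, Polynomial.eval_mul,
        Polynomial.eval_C, eval_chebyshev_sin]
      congr 1
      refine Finset.sum_congr rfl fun n _ => ?_
      have : ((-1 : ℝ) ^ n) * (-1) ^ n = 1 := by rw [← mul_pow]; simp
      simp only [ha]
      linear_combination (2 / Real.pi * sinPowCoeff p n * Real.cos (2 * n * θ)) * this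
    have htail := (hhas θ).summable.sum_add_tsum_nat_add (N + 1)
    rw [(hhas θ).tsum_eq] at htail
    rw [heval, show |Real.sin θ| ^ p - (∑ n ∈ Finset.range (N + 1), a n θ -
      sinPowCoeff p 0 / Real.pi) = ∑' i, a (i + (N + 1)) θ by linarith]
    have hle : ∀ i, ‖a (i + (N + 1)) θ‖ ≤
        2 / Real.pi * (s * sinPowCoeff p ((i + (N + 1) : ℕ) : ℤ)) := by
      intro i
      have hpi : 0 ≤ 2 / Real.pi := by positivity
      rw [← habs _ (by push_cast at hmN ⊢; linarith [Nat.cast_nonneg (α := ℝ) i])]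
      simp only [ha, norm_mul, Real.norm_eq_abs, abs_of_nonneg hpi]
      exact mul_le_of_le_one_right (by positivity) (Real.abs_cos_le_one _)
    have hb := tsum_of_norm_bounded ((hsumtail _ hmN).mul_left (2 / Real.pi)).hasSum hle
    rw [tsum_mul_left, Real.norm_eq_abs] at hb
    refine hb.trans ?_
    have hN0 : (0 : ℝ) < (N + 1 : ℕ) := by positivity
    have ht : ∑' i : ℕ, s * sinPowCoeff p ((i + (N + 1) : ℕ) : ℤ) ≤
        2 * C₀ / p * (2 ^ p * (L : ℝ) ^ (-p)) := by
      refine (Real.tsum_le_of_sum_range_le (fun i => hpos _ ?_)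
        (sum_range_sinPowCoeff_le hp hpos hmN)).trans ?_
      · push_cast at hmN ⊢; linarith [Nat.cast_nonneg (α := ℝ) i]
      have h1 : ((N + 1 : ℕ) : ℝ) * ((N + 1 : ℕ) : ℝ) ^ (-(p + 1)) = ((N + 1 : ℕ) : ℝ) ^ (-p) := by
        rw [show -(p + 1) = -p - 1 by ring, Real.rpow_sub_one hN0.ne', mul_div_cancel₀ _ hN0.ne']
      have h2 : ((N + 1 : ℕ) : ℝ) ^ (-p) ≤ 2 ^ p * (L : ℝ) ^ (-p) := by
        have : ((L : ℝ) / 2) ^ (-p) = 2 ^ p * (L : ℝ) ^ (-p) := by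
          rw [Real.div_rpow hL0.le two_pos.le, Real.rpow_neg two_pos.le, div_inv_eq_mul, mul_comm]
        rw [← this]
        exact Real.rpow_le_rpow_of_nonpos (by positivity) hLN (by linarith)
      rw [div_mul_eq_mul_div]
      refine div_le_div_of_nonneg_right ?_ hp.le
      calc _ ≤ (2 * ((N + 1 : ℕ) : ℝ)) * (C₀ * ((N + 1 : ℕ) : ℝ) ^ (-(p + 1))) :=
            mul_le_mul (by linarith) (hcoef _ hmN).2 (hpos _ hmN) (by positivity)
        _ = 2 * C₀ * ((N + 1 : ℕ) : ℝ) ^ (-p) := by rw [← h1]; ring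
        _ ≤ _ := by gcongr
    calc _ ≤ 2 / Real.pi * (2 * C₀ / p * (2 ^ p * (L : ℝ) ^ (-p))) := by gcongr
      _ = _ := by ring

theorem integrable_of_continuous_of_icc {π : Measure ℝ} [IsFiniteMeasure π] {A : ℝ}
    (hπ : π (Set.Icc (-A) A)ᶜ = 0) {g : ℝ → ℝ} (hg : Continuous g) : Integrable g π := by
  have h := hg.continuousOn.integrableOn_compact (μ := π) (isCompact_Icc (a := -A) (b := A))
  rwa [IntegrableOn, Measure.restrict_eq_self_of_ae_mem] at h
  exact hπ

theorem integral_eval_eq_of_moments {π₀ π₁ : Measure ℝ} [IsProbabilityMeasure π₀]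
    [IsProbabilityMeasure π₁] {A : ℝ} (h₀ : π₀ (Set.Icc (-A) A)ᶜ = 0)
    (h₁ : π₁ (Set.Icc (-A) A)ᶜ = 0) {L : ℕ}
    (hm : ∀ l : ℕ, 1 ≤ l → l ≤ L → ∫ v, v ^ l ∂π₀ = ∫ v, v ^ l ∂π₁) {P : Polynomial ℝ}
    (hP : P.natDegree ≤ L) : ∫ v, P.eval v ∂π₀ = ∫ v, P.eval v ∂π₁ := by
  simp_rw [Polynomial.eval_eq_sum_range]
  rw [integral_finsetSum _ fun i _ => integrable_of_continuous_of_icc h₀ (by fun_prop),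
    integral_finsetSum _ fun i _ => integrable_of_continuous_of_icc h₁ (by fun_prop)]
  refine Finset.sum_congr rfl fun i hi => ?_
  rw [integral_const_mul, integral_const_mul]
  rcases Nat.eq_zero_or_pos i with rfl | hi0
  · simp
  · rw [hm i hi0 (by have := Finset.mem_range.1 hi; omega)]

theorem abs_integral_le_of_icc {π : Measure ℝ} [IsProbabilityMeasure π] {A : ℝ}
    (hπ : π (Set.Icc (-A) A)ᶜ = 0) {g : ℝ → ℝ} {E : ℝ}
    (h : ∀ x ∈ Set.Icc (-A) A, |g x| ≤ E) : |∫ v, g v ∂π| ≤ E := by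
  have hae : ∀ᵐ v ∂π, ‖g v‖ ≤ E := by
    have h' : ∀ᵐ v ∂π, v ∈ Set.Icc (-A) A := hπ
    filter_upwards [h'] with v hv using h v hv
  simpa using norm_integral_le_of_norm_le_const hae

theorem momentMatchingGap_le {p : ℝ} (hp : 1 ≤ p) (hp_even : ∀ k : ℕ, p ≠ 2 * (k : ℝ)) :
    ∃ C : ℝ, 0 < C ∧ ∀ L : ℕ, 1 ≤ L → momentMatchingGap p L ≤ C * (L : ℝ) ^ (-p) := by
  have hp0 : 0 < p := by linarith
  obtain ⟨C, hC, happ⟩ := exists_polynomial_approx_abs_rpow hp0 hp_even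
  refine ⟨max (2 * C) (p ^ p), lt_max_of_lt_left (by positivity), fun L hL => ?_⟩
  have hL0 : (0 : ℝ) < L := by exact_mod_cast hL
  refine csSup_le (momentMatchingGaps_nonempty p L) ?_
  rintro r ⟨π₀, π₁, i₀, i₁, h₀, h₁, hm, rfl⟩
  rcases le_or_gt p L with hpL | hpL
  · obtain ⟨P, hPd, hP⟩ := happ L hL hpL
    have hac : Continuous fun v : ℝ => |v| ^ p := continuous_abs.rpow_const fun _ => Or.inr hp0.le
    have hPc : Continuous fun v => P.eval v := P.continuous
    have e₀ := abs_integral_le_of_icc h₀ hP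
    have e₁ := abs_integral_le_of_icc h₁ hP
    rw [integral_sub (integrable_of_continuous_of_icc h₀ hac)
      (integrable_of_continuous_of_icc h₀ hPc)] at e₀
    rw [integral_sub (integrable_of_continuous_of_icc h₁ hac)
      (integrable_of_continuous_of_icc h₁ hPc)] at e₁
    have hPe := integral_eval_eq_of_moments h₀ h₁ hm hPd
    have h2 : 2 * C * (L : ℝ) ^ (-p) ≤ max (2 * C) (p ^ p) * (L : ℝ) ^ (-p) := by
      gcongr; exact le_max_left _ _
    linarith [(abs_le.1 e₀).1, (abs_le.1 e₁).2]
  -- For L < p the trivial bound 1 on the gap suffices, since p^p L^(-p) ≥ 1.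
  · have a₀ := (abs_rpow_integral_mem_Icc hp0.le π₀ h₀).1
    have a₁ := (abs_rpow_integral_mem_Icc hp0.le π₁ h₁).2
    have h1 : 1 ≤ p ^ p * (L : ℝ) ^ (-p) := by
      rw [Real.rpow_neg hL0.le, ← div_eq_mul_inv, one_le_div (Real.rpow_pos_of_pos hL0 p)]
      exact Real.rpow_le_rpow hL0.le hpL.le hp0.le
    have h2 : p ^ p * (L : ℝ) ^ (-p) ≤ max (2 * C) (p ^ p) * (L : ℝ) ^ (-p) := by
      gcongr; exact le_max_right _ _
    linarith

theorem momentMatchingGap_bounds {p : ℝ} (hp : 1 ≤ p) (hp_even : ∀ k : ℕ, p ≠ 2 * (k : ℝ)) :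
    ∃ c C : ℝ, 0 < c ∧ 0 < C ∧ ∀ L : ℕ, 1 ≤ L →
      c * (L : ℝ) ^ (-p) ≤ momentMatchingGap p L ∧
      momentMatchingGap p L ≤ C * (L : ℝ) ^ (-p) := by
  obtain ⟨c, _, hc, _, h⟩ := exists_moment_matching hp hp_even
  obtain ⟨C, hC, h'⟩ := momentMatchingGap_le hp hp_even
  refine ⟨c, C, hc, hC, fun L hL => ⟨?_, h' L hL⟩⟩
  obtain ⟨π₀, π₁, i₀, i₁, h₀, h₁, hm, -, hgap⟩ := h L hL
  exact hgap.trans (le_csSup (momentMatchingGaps_bddAbove (by linarith) L)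
    ⟨π₀, π₁, i₀, i₁, h₀, h₁, fun l _ hl => hm l hl, rfl⟩)

/-! ### Gaussian mixtures whose mixing measures share moments. -/

/-- Every index n of the tail is at least K, so inserting 2^(n-K) ≥ 1 only enlarges it and produces
the series of exp(2|z|). -/
theorem abs_exp_sub_sum_le (z : ℝ) (K : ℕ) :
    |Real.exp z - ∑ m ∈ Finset.range K, z ^ m / (m.factorial : ℝ)| ≤
      (1 / 2) ^ K * Real.exp (2 * |z|) := by
  have h1 : |Real.exp z - ∑ m ∈ Finset.range K, z ^ m / (m.factorial : ℝ)| ≤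
      Real.exp |z| - ∑ m ∈ Finset.range K, |z| ^ m / (m.factorial : ℝ) := by
    have := Complex.norm_exp_sub_sum_le_exp_norm_sub_sum z K
    rw [Complex.norm_real, Real.norm_eq_abs] at this
    rw [← Real.norm_eq_abs (_ - _), ← Complex.norm_real]
    push_cast
    exact this
  refine h1.trans ?_
  have hexp : ∀ t : ℝ, HasSum (fun n : ℕ => t ^ n / (n.factorial : ℝ)) (Real.exp t) := fun t => by
    rw [Real.exp_eq_exp_ℝ]
    exact NormedSpace.expSeries_div_hasSum_exp t
  have htail : ∀ t : ℝ, Real.exp t - ∑ m ∈ Finset.range K, t ^ m / (m.factorial : ℝ) =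
      ∑' i : ℕ, t ^ (i + K) / ((i + K).factorial : ℝ) := fun t => by
    have := (hexp t).summable.sum_add_tsum_nat_add K
    rw [(hexp t).tsum_eq] at this
    linarith
  have hs : ∀ t : ℝ, Summable fun i : ℕ => t ^ (i + K) / ((i + K).factorial : ℝ) := fun t =>
    (summable_nat_add_iff K).2 (hexp t).summable
  calc _ ≤ (1 / 2) ^ K * ∑' i : ℕ, (2 * |z|) ^ (i + K) / ((i + K).factorial : ℝ) := by
        rw [htail, ← tsum_mul_left]
        refine (hs _).tsum_le_tsum (fun i => ?_) ((hs _).mul_left _)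
        rw [← mul_div_assoc]
        refine div_le_div_of_nonneg_right ?_ (by positivity)
        rw [mul_pow, ← mul_assoc]
        refine le_mul_of_one_le_left (by positivity) ?_
        rw [pow_add, mul_left_comm, ← mul_pow]
        norm_num
        exact one_le_pow₀ (by norm_num)
    _ ≤ _ := by
        rw [← htail]
        have : 0 ≤ ∑ m ∈ Finset.range K, (2 * |z|) ^ m / (m.factorial : ℝ) := by positivity
        gcongr
        linarith

/-- The law of `v + σ Z` with `v ∼ ν` and `Z` standard normal. -/
noncomputable def gaussianMixture (σ : ℝ) (ν : Measure ℝ) : Measure ℝ :=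
  (ν.prod (gaussianReal 0 (Real.toNNReal (σ ^ 2)))).map fun z => z.1 + z.2

instance isProbabilityMeasure_gaussianMixture (σ : ℝ) (ν : Measure ℝ) [IsProbabilityMeasure ν] :
    IsProbabilityMeasure (gaussianMixture σ ν) :=
  Measure.isProbabilityMeasure_map (by fun_prop)

theorem gaussianReal_eq_map_const_add (σ v : ℝ) :
    gaussianReal v (Real.toNNReal (σ ^ 2)) =
      (gaussianReal 0 (Real.toNNReal (σ ^ 2))).map (fun x => v + x) := by
  rw [gaussianReal_map_const_add, zero_add]

theorem gaussianPDFReal_eq_mul_exp {σ : ℝ} (hσ : 0 < σ) (v x : ℝ) :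
    gaussianPDFReal v (Real.toNNReal (σ ^ 2)) x =
      gaussianPDFReal 0 (Real.toNNReal (σ ^ 2)) x *
        Real.exp (x / σ ^ 2 * v - 1 / (2 * σ ^ 2) * v ^ 2) := by
  simp only [gaussianPDFReal, Real.coe_toNNReal _ (sq_nonneg σ)]
  rw [mul_assoc (_)⁻¹, ← Real.exp_add]
  congr 2
  field_simp
  ring

/-- Relative to N(0, σ²) the likelihood ratio is the exponential of a quadratic in v, which
polynomials in v approximate. -/
theorem lintegral_gaussianMixture {σ : ℝ} (hσ : 0 < σ) (ν : Measure ℝ) [IsProbabilityMeasure ν]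
    {f : ℝ → ENNReal} (hf : Measurable f) :
    ∫⁻ x, f x ∂gaussianMixture σ ν = ∫⁻ x, f x *
      ∫⁻ v, ENNReal.ofReal (Real.exp (x / σ ^ 2 * v - 1 / (2 * σ ^ 2) * v ^ 2)) ∂ν
        ∂gaussianReal 0 (Real.toNNReal (σ ^ 2)) := by
  have hv : Real.toNNReal (σ ^ 2) ≠ 0 := by simpa using by positivity
  have hm : Measurable fun z : ℝ × ℝ =>
      ENNReal.ofReal (Real.exp (z.2 / σ ^ 2 * z.1 - 1 / (2 * σ ^ 2) * z.1 ^ 2)) := by fun_prop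
  rw [gaussianMixture, lintegral_map hf (by fun_prop), lintegral_prod _ (by fun_prop)]
  have h1 : ∀ v : ℝ, ∫⁻ x, f (v + x) ∂gaussianReal 0 (Real.toNNReal (σ ^ 2)) =
      ∫⁻ x, gaussianPDF 0 (Real.toNNReal (σ ^ 2)) x * (f x *
        ENNReal.ofReal (Real.exp (x / σ ^ 2 * v - 1 / (2 * σ ^ 2) * v ^ 2))) := by
    intro v
    rw [← lintegral_map (f := f) hf (measurable_const_add v), ← gaussianReal_eq_map_const_add,
      gaussianReal_of_var_ne_zero _ hv,
      lintegral_withDensity_eq_lintegral_mul _ (measurable_gaussianPDF _ _) hf]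
    refine lintegral_congr fun x => ?_
    rw [Pi.mul_apply, gaussianPDF, gaussianPDFReal_eq_mul_exp hσ,
      ENNReal.ofReal_mul (gaussianPDFReal_nonneg _ _ _), gaussianPDF]
    ring
  have hfm : Measurable fun x => f x *
      ∫⁻ v, ENNReal.ofReal (Real.exp (x / σ ^ 2 * v - 1 / (2 * σ ^ 2) * v ^ 2)) ∂ν :=
    hf.mul (Measurable.lintegral_prod_left' hm)
  simp_rw [h1]
  rw [lintegral_lintegral_swap (by
      refine Measurable.aemeasurable ?_
      have := measurable_gaussianPDF 0 (Real.toNNReal (σ ^ 2))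
      fun_prop),
    gaussianReal_of_var_ne_zero _ hv,
    lintegral_withDensity_eq_lintegral_mul _ (measurable_gaussianPDF _ _) hfm]
  refine lintegral_congr fun x => ?_
  rw [lintegral_const_mul _ (by fun_prop), lintegral_const_mul _ (by fun_prop), Pi.mul_apply]

/-- The first K Taylor terms of exp, composed with a quadratic, form a polynomial in v of degree at
most 2K, integrated equally by both measures; each measure contributes one remainder. -/
theorem integral_exp_quadratic_le {ν₀ ν₁ : Measure ℝ} [IsProbabilityMeasure ν₀]
    [IsProbabilityMeasure ν₁] {A : ℝ} (h₀ : ν₀ (Set.Icc (-A) A)ᶜ = 0)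
    (h₁ : ν₁ (Set.Icc (-A) A)ᶜ = 0) {K : ℕ}
    (hm : ∀ l : ℕ, 1 ≤ l → l ≤ 2 * K → ∫ v, v ^ l ∂ν₀ = ∫ v, v ^ l ∂ν₁) (a b : ℝ) :
    ∫ v, Real.exp (a * v - b * v ^ 2) ∂ν₀ ≤ ∫ v, Real.exp (a * v - b * v ^ 2) ∂ν₁ +
      2 * ((1 / 2) ^ K * Real.exp (2 * (|a| * A + |b| * A ^ 2))) := by
  set P : Polynomial ℝ := ∑ m ∈ Finset.range K, Polynomial.C ((m.factorial : ℝ)⁻¹) *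
    (Polynomial.C a * Polynomial.X - Polynomial.C b * Polynomial.X ^ 2) ^ m with hP
  have hdeg : P.natDegree ≤ 2 * K := by
    refine Polynomial.natDegree_sum_le_of_forall_le _ _ fun m hmK => ?_
    have h2 : (Polynomial.C a * Polynomial.X - Polynomial.C b * Polynomial.X ^ 2).natDegree ≤ 2 := by
      compute_degree
    refine (Polynomial.natDegree_C_mul_le _ _).trans
      ((Polynomial.natDegree_pow_le_of_le m h2).trans ?_)
    have := Finset.mem_range.1 hmK
    omega
  have heval : ∀ v : ℝ, P.eval v =
      ∑ m ∈ Finset.range K, (a * v - b * v ^ 2) ^ m / (m.factorial : ℝ) := fun v => by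
    simp only [hP, Polynomial.eval_finsetSum, Polynomial.eval_mul, Polynomial.eval_C,
      Polynomial.eval_pow, Polynomial.eval_sub, Polynomial.eval_X]
    exact Finset.sum_congr rfl fun m _ => by rw [div_eq_inv_mul]
  have hbd : ∀ v ∈ Set.Icc (-A) A, |Real.exp (a * v - b * v ^ 2) - P.eval v| ≤
      (1 / 2) ^ K * Real.exp (2 * (|a| * A + |b| * A ^ 2)) := by
    intro v hv
    rw [heval]
    refine (abs_exp_sub_sum_le _ K).trans ?_
    have hvA : |v| ≤ A := abs_le.2 hv
    gcongr
    refine (abs_sub _ _).trans ?_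
    rw [abs_mul, abs_mul, abs_pow]
    gcongr
  have hec : Continuous fun v : ℝ => Real.exp (a * v - b * v ^ 2) := by fun_prop
  have hPc : Continuous fun v => P.eval v := P.continuous
  have e₀ := abs_integral_le_of_icc h₀ hbd
  have e₁ := abs_integral_le_of_icc h₁ hbd
  rw [integral_sub (integrable_of_continuous_of_icc h₀ hec)
    (integrable_of_continuous_of_icc h₀ hPc)] at e₀
  rw [integral_sub (integrable_of_continuous_of_icc h₁ hec)
    (integrable_of_continuous_of_icc h₁ hPc)] at e₁
  have := integral_eval_eq_of_moments h₀ h₁ hm hdeg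
  linarith [(abs_le.1 e₀).2, (abs_le.1 e₁).1]

theorem lintegral_exp_abs_gaussianReal_le {σ : ℝ} (t : ℝ) :
    ∫⁻ x, ENNReal.ofReal (Real.exp (t * |x|)) ∂gaussianReal 0 (Real.toNNReal (σ ^ 2)) ≤
      ENNReal.ofReal (2 * Real.exp (σ ^ 2 * t ^ 2 / 2)) := by
  have hmgf : ∀ s : ℝ, ∫ x, Real.exp (s * x) ∂gaussianReal 0 (Real.toNNReal (σ ^ 2)) =
      Real.exp (σ ^ 2 * s ^ 2 / 2) := fun s => by
    have := congrFun (mgf_fun_id_gaussianReal (μ := 0) (v := Real.toNNReal (σ ^ 2))) s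
    simpa [mgf, Real.coe_toNNReal _ (sq_nonneg σ)] using this
  have hint : ∀ s : ℝ, Integrable (fun x => Real.exp (s * x))
    (gaussianReal 0 (Real.toNNReal (σ ^ 2))) := fun s => integrable_exp_mul_gaussianReal s
  have hle : ∀ x : ℝ, Real.exp (t * |x|) ≤ Real.exp (t * x) + Real.exp (-t * x) := fun x => by
    rcases abs_choice x with h | h <;> rw [h]
    · linarith [Real.exp_pos (-t * x)]
    · rw [mul_neg, ← neg_mul]; linarith [Real.exp_pos (t * x)]
  refine (lintegral_mono fun x => ENNReal.ofReal_le_ofReal (hle x)).trans ?_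
  have hadd : Integrable (fun x => Real.exp (t * x) + Real.exp (-t * x))
    (gaussianReal 0 (Real.toNNReal (σ ^ 2))) := (hint t).add (hint (-t))
  rw [← ofReal_integral_eq_lintegral_ofReal hadd
    (Filter.Eventually.of_forall fun x => by positivity)]
  refine ENNReal.ofReal_le_ofReal ?_
  rw [integral_add (hint t) (hint (-t)), hmgf, hmgf, neg_sq, two_mul]

/-- Gaussian mixtures whose mixing measures share their first `2K` moments are close. -/
theorem lintegral_gaussianMixture_le {σ : ℝ} (hσ : 0 < σ) {ν₀ ν₁ : Measure ℝ}
    [IsProbabilityMeasure ν₀] [IsProbabilityMeasure ν₁] {A : ℝ}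
    (h₀ : ν₀ (Set.Icc (-A) A)ᶜ = 0) (h₁ : ν₁ (Set.Icc (-A) A)ᶜ = 0) {K : ℕ}
    (hm : ∀ l : ℕ, 1 ≤ l → l ≤ 2 * K → ∫ v, v ^ l ∂ν₀ = ∫ v, v ^ l ∂ν₁)
    {f : ℝ → ENNReal} (hf : Measurable f) (hf1 : ∀ x, f x ≤ 1) :
    ∫⁻ x, f x ∂gaussianMixture σ ν₀ ≤ ∫⁻ x, f x ∂gaussianMixture σ ν₁ +
      ENNReal.ofReal (4 * (1 / 2) ^ K * Real.exp (3 * A ^ 2 / σ ^ 2)) := by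
  rw [lintegral_gaussianMixture hσ _ hf, lintegral_gaussianMixture hσ _ hf]
  -- E is the part of the remainder independent of x. The factor exp(2A|x|/σ²) has Gaussian mean at
  -- most 2 exp(2A²/σ²), giving 4 and exp(3A²/σ²) in total.
  set E : ℝ := 2 * (1 / 2) ^ K * Real.exp (A ^ 2 / σ ^ 2) with hE
  have hpt : ∀ x : ℝ,
      ∫⁻ v, ENNReal.ofReal (Real.exp (x / σ ^ 2 * v - 1 / (2 * σ ^ 2) * v ^ 2)) ∂ν₀ ≤
      ∫⁻ v, ENNReal.ofReal (Real.exp (x / σ ^ 2 * v - 1 / (2 * σ ^ 2) * v ^ 2)) ∂ν₁ +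
        ENNReal.ofReal E * ENNReal.ofReal (Real.exp (2 * A / σ ^ 2 * |x|)) := by
    intro x
    have hec : Continuous fun v : ℝ => Real.exp (x / σ ^ 2 * v - 1 / (2 * σ ^ 2) * v ^ 2) := by
      fun_prop
    rw [← ofReal_integral_eq_lintegral_ofReal (integrable_of_continuous_of_icc h₀ hec)
      (Filter.Eventually.of_forall fun _ => (Real.exp_pos _).le),
      ← ofReal_integral_eq_lintegral_ofReal (integrable_of_continuous_of_icc h₁ hec)
      (Filter.Eventually.of_forall fun _ => (Real.exp_pos _).le),
      ← ENNReal.ofReal_mul (by positivity), ← ENNReal.ofReal_add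
        (integral_nonneg fun _ => (Real.exp_pos _).le) (by positivity)]
    refine ENNReal.ofReal_le_ofReal ((integral_exp_quadratic_le h₀ h₁ hm _ _).trans_eq ?_)
    rw [hE, mul_assoc _ (Real.exp _), ← Real.exp_add, abs_div, abs_div, abs_of_pos (pow_pos hσ 2),
      abs_one, abs_of_pos (show 0 < 2 * σ ^ 2 by positivity), ← mul_assoc]
    congr 3
    field_simp
    ring
  calc _ ≤ ∫⁻ x, (f x *
        ∫⁻ v, ENNReal.ofReal (Real.exp (x / σ ^ 2 * v - 1 / (2 * σ ^ 2) * v ^ 2)) ∂ν₁ +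
        ENNReal.ofReal E * ENNReal.ofReal (Real.exp (2 * A / σ ^ 2 * |x|)))
        ∂gaussianReal 0 (Real.toNNReal (σ ^ 2)) := by
        refine lintegral_mono fun x => ?_
        refine (mul_le_mul_right (hpt x) (f x)).trans ?_
        rw [mul_add]
        exact add_le_add le_rfl (mul_le_of_le_one_left zero_le (hf1 x))
    _ ≤ _ := by
        rw [lintegral_add_right _ (by fun_prop), lintegral_const_mul _ (by fun_prop)]
        gcongr
        refine (mul_le_mul_right (lintegral_exp_abs_gaussianReal_le _) _).trans ?_
        rw [← ENNReal.ofReal_mul (by positivity)]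
        refine ENNReal.ofReal_le_ofReal (le_of_eq ?_)
        rw [hE, show 2 * (1 / 2) ^ K * Real.exp (A ^ 2 / σ ^ 2) *
          (2 * Real.exp (σ ^ 2 * (2 * A / σ ^ 2) ^ 2 / 2)) = 4 * (1 / 2) ^ K *
          (Real.exp (A ^ 2 / σ ^ 2) * Real.exp (σ ^ 2 * (2 * A / σ ^ 2) ^ 2 / 2)) by ring,
          ← Real.exp_add]
        congr 2
        field_simp
        ring

/-! ### Product measures and the two fuzzy hypotheses. -/

/-- Closeness in the sense of test functions tensorizes. -/
theorem lintegral_pi_le_add {μ ν : Measure ℝ} [IsProbabilityMeasure μ] [IsProbabilityMeasure ν]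
    {δ : ENNReal} (h : ∀ f : ℝ → ENNReal, Measurable f → (∀ x, f x ≤ 1) →
      ∫⁻ x, f x ∂μ ≤ ∫⁻ x, f x ∂ν + δ) (d : ℕ) :
    ∀ f : (Fin d → ℝ) → ENNReal, Measurable f → (∀ x, f x ≤ 1) →
      ∫⁻ x, f x ∂Measure.pi (fun _ => μ) ≤ ∫⁻ x, f x ∂Measure.pi (fun _ => ν) + d * δ := by
  induction d with
  | zero =>
    intro f hf hf1
    rw [Measure.pi_of_empty, Measure.pi_of_empty]
    simp
  | succ d ih =>
    intro f hf hf1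
    set e := (MeasurableEquiv.piFinSuccAbove (fun _ : Fin (d + 1) => ℝ) 0).symm with he
    have hfe : Measurable fun z : ℝ × (Fin d → ℝ) => f (e z) := hf.comp e.measurable
    have key : ∀ (κ : Measure ℝ) [IsProbabilityMeasure κ],
        ∫⁻ x, f x ∂Measure.pi (fun _ : Fin (d + 1) => κ) =
        ∫⁻ x, ∫⁻ y, f (e (x, y)) ∂Measure.pi (fun _ : Fin d => κ) ∂κ := by
      intro κ _
      rw [← ((measurePreserving_piFinSuccAbove (fun _ : Fin (d + 1) => κ) 0).symm).lintegral_comp hf,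
        lintegral_prod _ hfe.aemeasurable]
    rw [key, key]
    have hinner : Measurable fun x : ℝ => ∫⁻ y, f (e (x, y)) ∂Measure.pi (fun _ : Fin d => ν) :=
      hfe.lintegral_prod_right'
    calc _ ≤ ∫⁻ x, (∫⁻ y, f (e (x, y)) ∂Measure.pi (fun _ : Fin d => ν) + d * δ) ∂μ :=
          lintegral_mono fun x => ih _ (hfe.comp measurable_prodMk_left) fun y => hf1 _
      _ = ∫⁻ x, ∫⁻ y, f (e (x, y)) ∂Measure.pi (fun _ : Fin d => ν) ∂μ + d * δ := by
          rw [lintegral_add_left hinner, lintegral_const, measure_univ, mul_one]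
      _ ≤ (∫⁻ x, ∫⁻ y, f (e (x, y)) ∂Measure.pi (fun _ : Fin d => ν) ∂ν + δ) + d * δ := by
          gcongr
          refine h _ hinner fun x => ?_
          refine (lintegral_mono fun y => hf1 _).trans ?_
          simp
      _ = _ := by push_cast; ring

/-- Averaging the Gaussian sequence model over an i.i.d. prior gives a product of mixtures. -/
theorem lintegral_gaussianSequence_pi (σ : ℝ) (ν : Measure ℝ) [IsProbabilityMeasure ν] {d : ℕ}
    {B : Set (Fin d → ℝ)} (hB : MeasurableSet B) :
    ∫⁻ v, gaussianSequence σ v B ∂Measure.pi (fun _ => ν) =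
      Measure.pi (fun _ => gaussianMixture σ ν) B := by
  set γ := gaussianReal 0 (Real.toNNReal (σ ^ 2)) with hγ
  have hadd : Measurable fun z : (Fin d → ℝ) × (Fin d → ℝ) => z.1 + z.2 := by fun_prop
  have hplus : Measurable fun z : ℝ × ℝ => z.1 + z.2 := by fun_prop
  have h1 : Measure.pi (fun _ : Fin d => gaussianMixture σ ν) =
      (Measure.pi fun _ : Fin d => ν.prod γ).map fun z i => (z i).1 + (z i).2 :=
    (Measure.pi_map_pi (f := fun _ (z : ℝ × ℝ) => z.1 + z.2)
      fun _ => hplus.aemeasurable).symm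
  have h2 : (Measure.pi fun _ : Fin d => ν.prod γ).map (fun z i => (z i).1 + (z i).2) =
      ((Measure.pi fun _ : Fin d => ν).prod (Measure.pi fun _ : Fin d => γ)).map
        fun z => z.1 + z.2 := by
    rw [← (measurePreserving_arrowProdEquivProdArrow ℝ ℝ (Fin d) (fun _ => ν)
      (fun _ => γ)).map_eq, Measure.map_map hadd (MeasurableEquiv.measurable _)]
    rfl
  rw [h1, h2, Measure.map_apply hadd hB, Measure.prod_apply (hadd hB)]
  refine lintegral_congr fun v => ?_
  have h3 : gaussianSequence σ v = (Measure.pi fun _ : Fin d => γ).map fun w => v + w := by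
    rw [gaussianSequence]
    simp_rw [gaussianReal_eq_map_const_add σ (v _)]
    exact (Measure.pi_map_pi (f := fun i (x : ℝ) => v i + x)
      fun i => (measurable_const_add (v i)).aemeasurable).symm
  rw [h3, Measure.map_apply (measurable_const_add v) hB]
  rfl

/-- The prior need not be supported on the hypothesis: outside `S` the probability is bounded by 1,
at the price of the prior mass there. -/
theorem pi_gaussianMixture_le (σ : ℝ) (ν : Measure ℝ) [IsProbabilityMeasure ν] {d : ℕ}
    {B S : Set (Fin d → ℝ)} (hB : MeasurableSet B) (hS : MeasurableSet S) {a : ENNReal}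
    (h : ∀ v ∈ S, gaussianSequence σ v B ≤ a) :
    Measure.pi (fun _ => gaussianMixture σ ν) B ≤ a + Measure.pi (fun _ => ν) Sᶜ := by
  rw [← lintegral_gaussianSequence_pi σ ν hB]
  calc _ ≤ ∫⁻ v, (a + Sᶜ.indicator 1 v) ∂Measure.pi (fun _ => ν) := by
        refine lintegral_mono fun v => ?_
        by_cases hv : v ∈ S
        · simpa [hv] using h v hv
        · have hp : gaussianSequence σ v B ≤ 1 := by
            have : IsProbabilityMeasure (gaussianSequence σ v) := by
              unfold gaussianSequence; infer_instance
            exact prob_le_one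
          simpa [hv] using le_add_left hp
    _ = _ := by
        rw [lintegral_add_left measurable_const, lintegral_const, measure_univ, mul_one,
          lintegral_indicator_one hS.compl]

/-- The method of two fuzzy hypotheses for the Gaussian sequence model. -/
theorem one_le_of_priors {σ : ℝ} {ν₀ ν₁ : Measure ℝ} [IsProbabilityMeasure ν₀]
    [IsProbabilityMeasure ν₁] {d : ℕ} {ψ : (Fin d → ℝ) → Bool} (hψ : Measurable ψ)
    {S₀ S₁ : Set (Fin d → ℝ)} (hS₀ : MeasurableSet S₀) (hS₁ : MeasurableSet S₁) {a b δ : ENNReal}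
    (h₀ : ∀ v ∈ S₀, gaussianSequence σ v {x | ψ x = true} ≤ a)
    (h₁ : ∀ v ∈ S₁, gaussianSequence σ v {x | ψ x = false} ≤ b)
    (hδ : ∀ f : ℝ → ENNReal, Measurable f → (∀ x, f x ≤ 1) →
      ∫⁻ x, f x ∂gaussianMixture σ ν₁ ≤ ∫⁻ x, f x ∂gaussianMixture σ ν₀ + δ) :
    1 ≤ (a + Measure.pi (fun _ => ν₀) S₀ᶜ) + d * δ + (b + Measure.pi (fun _ => ν₁) S₁ᶜ) := by
  have hB : MeasurableSet {x | ψ x = true} := hψ (measurableSet_singleton true)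
  have hB' : MeasurableSet {x | ψ x = false} := hψ (measurableSet_singleton false)
  have hc : {x | ψ x = false} = {x | ψ x = true}ᶜ := by ext; simp
  have e₀ := pi_gaussianMixture_le σ ν₀ hB hS₀ h₀
  have e₁ := pi_gaussianMixture_le σ ν₁ hB' hS₁ h₁
  have e₂ := lintegral_pi_le_add hδ d ({x | ψ x = true}.indicator 1)
    (measurable_one.indicator hB) fun x => Set.indicator_le_self' (by simp) x
  rw [lintegral_indicator_one hB, lintegral_indicator_one hB] at e₂
  calc (1 : ENNReal) = Measure.pi (fun _ => gaussianMixture σ ν₁) {x | ψ x = true} +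
        Measure.pi (fun _ => gaussianMixture σ ν₁) {x | ψ x = false} := by
        rw [hc, measure_add_measure_compl hB, measure_univ]
    _ ≤ _ := add_le_add (e₂.trans (add_le_add_left e₀ _)) e₁

/-! ### Priors with separated p-th moments, and their concentration. -/

/-- An equal mixture of a rescaled measure and a point mass. -/
theorem exists_rescaled_mixture {π : Measure ℝ} [IsProbabilityMeasure π]
    (hπ : π (Set.Icc (-1) 1)ᶜ = 0) {A u : ℝ} (hA : 0 ≤ A) (hu : u ∈ Set.Icc (-A) A) :
    ∃ ν : Measure ℝ, IsProbabilityMeasure ν ∧ ν (Set.Icc (-A) A)ᶜ = 0 ∧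
      ∀ g : ℝ → ℝ, Continuous g → ∫ v, g v ∂ν = (∫ v, g (A * v) ∂π + g u) / 2 := by
  have hmul : Measurable fun v : ℝ => A * v := by fun_prop
  have h2 : (2 : ENNReal)⁻¹ ≠ ⊤ := by simp
  have hprob : IsProbabilityMeasure (π.map fun v => A * v) :=
    Measure.isProbabilityMeasure_map hmul.aemeasurable
  have hmap : (π.map fun v => A * v) (Set.Icc (-A) A)ᶜ = 0 := by
    rw [Measure.map_apply hmul measurableSet_Icc.compl]
    refine measure_mono_null (Set.compl_subset_compl.2 fun v hv => ?_) hπ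
    constructor <;> nlinarith [hv.1, hv.2]
  refine ⟨(2 : ENNReal)⁻¹ • π.map (fun v => A * v) + (2 : ENNReal)⁻¹ • Measure.dirac u,
    ⟨?_⟩, ?_, fun g hg => ?_⟩
  · simp [ENNReal.inv_two_add_inv_two]
  · rw [Measure.add_apply, Measure.smul_apply, Measure.smul_apply, hmap,
      Measure.dirac_apply' _ measurableSet_Icc.compl, Set.indicator_of_notMem (not_not.2 hu)]
    simp
  · rw [integral_add_measure ((integrable_of_continuous_of_icc hmap hg).smul_measure h2)
      ((integrable_dirac (by simp)).smul_measure h2), integral_smul_measure,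
      integral_smul_measure, integral_dirac, integral_map hmul.aemeasurable
        hg.aestronglyMeasurable]
    simp only [ENNReal.toReal_inv, ENNReal.toReal_ofNat, smul_eq_mul]
    ring

/-- Priors on `[-r ℓ, r ℓ]` sharing at least `16 ℓ` moments, whose `p`-th absolute moments are
separated by a constant factor around a prescribed level `t` of order `r ^ p`. -/
theorem exists_priors {p : ℝ} (hp : 1 ≤ p) (hp_even : ∀ k : ℕ, p ≠ 2 * (k : ℝ)) {a b : ℝ}
    (ha : 0 < a) (hb : 0 < b) :
    ∃ η ℓ₀ : ℝ, 0 < η ∧ ∀ ℓ : ℝ, ℓ₀ ≤ ℓ → ∀ r : ℝ, 0 < r → ∀ t : ℝ,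
      (a * r) ^ p ≤ t → t ≤ (b * r) ^ p →
      ∃ ν₀ ν₁ : Measure ℝ, ∃ K : ℕ, IsProbabilityMeasure ν₀ ∧ IsProbabilityMeasure ν₁ ∧
        ν₀ (Set.Icc (-(r * ℓ)) (r * ℓ))ᶜ = 0 ∧ ν₁ (Set.Icc (-(r * ℓ)) (r * ℓ))ᶜ = 0 ∧
        8 * ℓ ≤ K ∧ (∀ l : ℕ, 1 ≤ l → l ≤ 2 * K → ∫ v, v ^ l ∂ν₀ = ∫ v, v ^ l ∂ν₁) ∧
        ∫ v, |v| ^ p ∂ν₀ = (1 - η) * t ∧ (1 + 3 * η) * t ≤ ∫ v, |v| ^ p ∂ν₁ := by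
  have hp0 : 0 < p := by linarith
  obtain ⟨c, C, hc, hC, hmatch⟩ := exists_moment_matching hp hp_even
  -- About 2Bℓ moments are matched. The second entry makes the rescaled moment A^p m₀ at most (ar)^p
  -- ≤ t, leaving room for the point mass.
  set B : ℝ := max 8 (C ^ (1 / p) / a) with hB
  have hB8 : 8 ≤ B := le_max_left _ _
  have hB0 : 0 < B := by linarith
  have hBC : C ≤ (a * B) ^ p := by
    have h1 : C ^ (1 / p) ≤ a * B := by
      rw [mul_comm, ← div_le_iff₀ ha]; exact le_max_right _ _
    calc C = (C ^ (1 / p)) ^ p := by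
          rw [← Real.rpow_mul hC.le, one_div_mul_cancel hp0.ne', Real.rpow_one]
      _ ≤ _ := Real.rpow_le_rpow (by positivity) h1 hp0.le
  -- The bound 1/2 will give w ≥ 0. The other entry makes the rescaled gap at least 8ηt, as 2K ≤
  -- 4Bℓ; half of it moves the mean from (1 - η)t to (1 + 3η)t.
  set η : ℝ := min (1 / 2) (c * (4 * B * b) ^ (-p) / 8) with hη
  have hη0 : 0 < η := lt_min (by norm_num) (by positivity)
  have hη1 : η ≤ 1 / 2 := min_le_left _ _
  have hη2 : 8 * η ≤ c * (4 * B * b) ^ (-p) := by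
    have : η ≤ c * (4 * B * b) ^ (-p) / 8 := min_le_right _ _
    linarith
  refine ⟨η, max 1 (2 * b), hη0, fun ℓ hℓ r hr t hat htb => ?_⟩
  have hℓ1 : 1 ≤ ℓ := (le_max_left _ _).trans hℓ
  have hℓb : 2 * b ≤ ℓ := (le_max_right _ _).trans hℓ
  have hℓ0 : 0 < ℓ := by linarith
  set K := ⌈B * ℓ⌉₊ with hK
  have hK1 : B * ℓ ≤ K := Nat.le_ceil _
  have hK2 : (K : ℝ) < B * ℓ + 1 := Nat.ceil_lt_add_one (by positivity)
  have hBℓ : 1 ≤ B * ℓ := by nlinarith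
  have hKpos : 1 ≤ 2 * K := by
    have : (1 : ℝ) ≤ K := by linarith
    have : 1 ≤ K := by exact_mod_cast this
    omega
  obtain ⟨π₀, π₁, i₀, i₁, s₀, s₁, hm, hm₀, hgap⟩ := hmatch (2 * K) hKpos
  set A := r * ℓ with hA
  have hA0 : 0 < A := by positivity
  set m₀ := ∫ v, |v| ^ p ∂π₀
  set m₁ := ∫ v, |v| ^ p ∂π₁
  have ht0 : 0 < t := lt_of_lt_of_le (by positivity) hat
  have hup : A ^ p * m₀ ≤ t := by
    have h1 : ((2 * K : ℕ) : ℝ) ^ (-p) ≤ (B * ℓ) ^ (-p) :=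
      Real.rpow_le_rpow_of_nonpos (by positivity) (by push_cast; linarith) (by linarith)
    calc A ^ p * m₀ ≤ A ^ p * ((a * B) ^ p * (B * ℓ) ^ (-p)) := by
          refine mul_le_mul_of_nonneg_left (hm₀.trans ?_) (by positivity)
          exact mul_le_mul hBC h1 (by positivity) (by positivity)
      _ = (a * r) ^ p := by
          rw [Real.rpow_neg (by positivity), ← div_eq_mul_inv,
            ← Real.div_rpow (by positivity) (by positivity),
            ← Real.mul_rpow (by positivity) (by positivity)]
          congr 1
          rw [hA]; field_simp
      _ ≤ t := hat
  have hlow : 8 * η * t ≤ A ^ p * (m₁ - m₀) := by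
    have h1 : (4 * (B * ℓ)) ^ (-p) ≤ ((2 * K : ℕ) : ℝ) ^ (-p) :=
      Real.rpow_le_rpow_of_nonpos (by positivity) (by push_cast; linarith) (by linarith)
    calc 8 * η * t ≤ c * (4 * B * b) ^ (-p) * (b * r) ^ p := by gcongr
      _ = A ^ p * (c * (4 * (B * ℓ)) ^ (-p)) := by
          have : (4 * B * b) ^ (-p) * (b * r) ^ p = A ^ p * (4 * (B * ℓ)) ^ (-p) := by
            rw [Real.rpow_neg (by positivity), Real.rpow_neg (by positivity), mul_comm,
              ← div_eq_mul_inv, ← div_eq_mul_inv, ← Real.div_rpow (by positivity) (by positivity),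
              ← Real.div_rpow (by positivity) (by positivity)]
            congr 1
            rw [hA]; field_simp
          linear_combination c * this
      _ ≤ A ^ p * (m₁ - m₀) := by
          refine mul_le_mul_of_nonneg_left (le_trans ?_ hgap) (by positivity)
          gcongr
  -- Solves (A^p m₀ + u^p)/2 = (1 - η)t with u^p = w. Both priors use the same u, so their moments
  -- still match and the gap is only halved.
  set w := 2 * ((1 - η) * t) - A ^ p * m₀ with hw
  have hw0 : 0 ≤ w := by nlinarith
  have hm₀0 : 0 ≤ m₀ := integral_nonneg fun v => by positivity
  set u := w ^ (1 / p) with hu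
  have hu0 : 0 ≤ u := by positivity
  have hup' : u ^ p = w := by
    rw [hu, ← Real.rpow_mul hw0, one_div_mul_cancel hp0.ne', Real.rpow_one]
  -- The point mass must lie in the support interval: u^p ≤ 2t ≤ (2br)^p, and 2b ≤ ℓ.
  have huA : u ≤ A := by
    rw [← Real.rpow_le_rpow_iff hu0 hA0.le hp0, hup']
    have h2 : (2 : ℝ) ≤ 2 ^ p := by
      simpa using Real.rpow_le_rpow_of_exponent_le (one_le_two : (1 : ℝ) ≤ 2) hp
    calc w ≤ 2 * t := by
          have : 0 ≤ A ^ p * m₀ := by positivity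
          nlinarith
      _ ≤ 2 ^ p * (b * r) ^ p := by gcongr
      _ = (2 * b * r) ^ p := by rw [mul_assoc, ← Real.mul_rpow (by positivity) (by positivity)]
      _ ≤ A ^ p := by
          refine Real.rpow_le_rpow (by positivity) ?_ hp0.le
          rw [hA]; nlinarith
  have huI : u ∈ Set.Icc (-A) A := ⟨by linarith, huA⟩
  obtain ⟨ν₀, j₀, S₀, I₀⟩ := exists_rescaled_mixture s₀ hA0.le huI
  obtain ⟨ν₁, j₁, S₁, I₁⟩ := exists_rescaled_mixture s₁ hA0.le huI
  have hac : Continuous fun v : ℝ => |v| ^ p := continuous_abs.rpow_const fun _ => Or.inr hp0.le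
  have hscale : ∀ v : ℝ, |A * v| ^ p = A ^ p * |v| ^ p := fun v => by
    rw [abs_mul, abs_of_pos hA0, Real.mul_rpow hA0.le (abs_nonneg v)]
  have huabs : |u| ^ p = w := by rw [abs_of_nonneg hu0, hup']
  refine ⟨ν₀, ν₁, K, j₀, j₁, S₀, S₁, by nlinarith, fun l _ hl => ?_, ?_, ?_⟩
  · rw [I₀ _ (continuous_pow l), I₁ _ (continuous_pow l)]
    simp_rw [mul_pow, integral_const_mul, hm l hl]
  · rw [I₀ _ hac]
    simp_rw [hscale, integral_const_mul]
    rw [huabs, hw]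
    ring
  · rw [I₁ _ hac]
    simp_rw [hscale, integral_const_mul]
    rw [huabs, hw]
    linarith

/-- Chebyshev's inequality is enough: for the priors, A^p exceeds the deviation h only by a power of
log d, against a factor d in the denominator. -/
theorem pi_abs_sum_sub_ge_le {p : ℝ} (hp : 0 ≤ p) {ν : Measure ℝ} [IsProbabilityMeasure ν]
    {A : ℝ} (hν : ν (Set.Icc (-A) A)ᶜ = 0) {d : ℕ} (hd : 0 < d) {h : ℝ} (hh : 0 < h) :
    Measure.pi (fun _ : Fin d => ν) {v | d * h ≤ |∑ i, |v i| ^ p - d * ∫ x, |x| ^ p ∂ν|} ≤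
      ENNReal.ofReal ((A ^ p) ^ 2 / (d * h ^ 2)) := by
  have hd0 : (0 : ℝ) < d := by exact_mod_cast hd
  have hac : Continuous fun v : ℝ => |v| ^ p := continuous_abs.rpow_const fun _ => Or.inr hp
  have hsupp : ∀ᵐ v ∂ν, v ∈ Set.Icc (-A) A := hν
  have hbd : ∀ᵐ v ∂ν, ‖|v| ^ p‖ ≤ A ^ p := by
    filter_upwards [hsupp] with v hv
    rw [Real.norm_of_nonneg (by positivity)]
    exact Real.rpow_le_rpow (abs_nonneg v) (abs_le.2 hv) hp
  have hLp : MemLp (fun v : ℝ => |v| ^ p) 2 ν := MemLp.of_bound hac.aestronglyMeasurable _ hbd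
  have hev : ∀ i : Fin d, MemLp (fun v : Fin d → ℝ => |v i| ^ p) 2 (Measure.pi fun _ => ν) :=
    fun i => hLp.comp_measurePreserving (measurePreserving_eval (fun _ : Fin d => ν) i)
  set X : (Fin d → ℝ) → ℝ := ∑ i, fun v => |v i| ^ p with hX
  have hXv : ∀ v, X v = ∑ i, |v i| ^ p := fun v => by rw [hX, Finset.sum_apply]
  have hXLp : MemLp X 2 (Measure.pi fun _ => ν) := memLp_finsetSum' _ fun i _ => hev i
  have hmean : ∫ v, X v ∂Measure.pi (fun _ => ν) = d * ∫ x, |x| ^ p ∂ν := by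
    simp_rw [hXv]
    rw [integral_finsetSum _ fun i _ => (hev i).integrable one_le_two]
    simp_rw [integral_comp_eval (μ := fun _ : Fin d => ν) (f := fun x : ℝ => |x| ^ p)
      hac.aestronglyMeasurable]
    simp
  have hvar1 : variance (fun v : ℝ => |v| ^ p) ν ≤ (A ^ p) ^ 2 := by
    refine (variance_le_expectation_sq hac.aestronglyMeasurable).trans ?_
    have : ∀ᵐ v ∂ν, ‖((fun v : ℝ => |v| ^ p) ^ 2) v‖ ≤ (A ^ p) ^ 2 := by
      filter_upwards [hbd] with v hv
      rw [Pi.pow_apply, norm_pow]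
      exact pow_le_pow_left₀ (norm_nonneg _) hv 2
    refine (le_abs_self _).trans ?_
    simpa using norm_integral_le_of_norm_le_const this
  have hvar : variance X (Measure.pi fun _ => ν) ≤ d * (A ^ p) ^ 2 := by
    rw [hX, variance_sum_pi (X := fun _ (x : ℝ) => |x| ^ p) fun _ => hLp]
    simpa using mul_le_mul_of_nonneg_left hvar1 hd0.le
  have hcheb := meas_ge_le_variance_div_sq hXLp (c := d * h) (by positivity)
  rw [hmean] at hcheb
  simp_rw [hXv] at hcheb
  refine hcheb.trans (ENNReal.ofReal_le_ofReal ?_)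
  calc _ ≤ d * (A ^ p) ^ 2 / (d * h) ^ 2 := by gcongr
    _ = _ := by field_simp

/-- 8 log 2 > 5. The rate 5 has to beat the 3 in exp(3A²/σ²) by more than 1, to survive d
coordinates. -/
theorem half_pow_le_exp {ℓ : ℝ} {K : ℕ} (hK : 8 * ℓ ≤ K) :
    (1 / 2 : ℝ) ^ K ≤ Real.exp (-(5 * ℓ)) := by
  rw [one_div, inv_pow, Real.exp_neg]
  refine inv_anti₀ (Real.exp_pos _) ?_
  rw [← Real.exp_log (show (0 : ℝ) < 2 ^ K by positivity), Real.log_pow]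
  refine Real.exp_le_exp.2 ?_
  nlinarith [Real.log_two_gt_d9]

/-! ### Lower bound on the critical separation. -/

theorem lpNormVec_le_iff {p : ℝ} (hp : 0 < p) {d : ℕ} (v : Fin d → ℝ) {ε : ℝ} (hε : 0 ≤ ε) :
    lpNormVec p v ≤ ε ↔ ∑ i, |v i| ^ p ≤ ε ^ p := by
  have h0 : 0 ≤ ∑ i, |v i| ^ p := by positivity
  rw [lpNormVec_eq hp, one_div, Real.rpow_inv_le_iff_of_pos h0 hε hp]

theorem le_lpNormVec_iff {p : ℝ} (hp : 0 < p) {d : ℕ} (v : Fin d → ℝ) {ε : ℝ} (hε : 0 ≤ ε) :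
    ε ≤ lpNormVec p v ↔ ε ^ p ≤ ∑ i, |v i| ^ p := by
  have h0 : 0 ≤ ∑ i, |v i| ^ p := by positivity
  rw [lpNormVec_eq hp, one_div, Real.le_rpow_inv_iff_of_pos hε h0 hp]

theorem eventually_error_lt {p a η γ : ℝ} (ha : 0 < a) (hη : 0 < η) (hγ : 0 < γ) (ℓ₀ : ℝ) :
    ∀ᶠ d : ℕ in Filter.atTop, ℓ₀ ≤ Real.log d ∧ 0 < Real.log d ∧
      2 * ((Real.log d ^ p) ^ 2 / (d * (η * a ^ p) ^ 2)) + 4 / d < γ := by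
  have hlog : Filter.Tendsto (fun d : ℕ => Real.log d) Filter.atTop Filter.atTop :=
    Real.tendsto_log_atTop.comp tendsto_natCast_atTop_atTop
  have h1 : Filter.Tendsto (fun d : ℕ => Real.log d ^ (p * 2) / (d : ℝ)) Filter.atTop (nhds 0) := by
    have := (isLittleO_log_rpow_rpow_atTop (p * 2) one_pos).tendsto_div_nhds_zero.comp
      tendsto_natCast_atTop_atTop
    simpa [Function.comp_def] using this
  have h2 : Filter.Tendsto (fun d : ℕ => 2 / (η * a ^ p) ^ 2 * (Real.log d ^ (p * 2) / (d : ℝ)) +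
      4 / (d : ℝ)) Filter.atTop (nhds 0) := by
    simpa using (h1.const_mul (2 / (η * a ^ p) ^ 2)).add (tendsto_const_div_atTop_nhds_zero_nat 4)
  filter_upwards [hlog.eventually_ge_atTop ℓ₀, hlog.eventually_gt_atTop 0,
    h2.eventually_lt_const hγ] with d hd1 hd2 hd3
  refine ⟨hd1, hd2, lt_of_eq_of_lt ?_ hd3⟩
  rw [← Real.rpow_mul_natCast hd2.le]
  push_cast
  field_simp

theorem ofReal_le_criticalSeparation {p : ℝ} (hp : 1 ≤ p) (hp_even : ∀ k : ℕ, p ≠ 2 * (k : ℝ))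
    {α β : ℝ} (hα : 0 < α) (hβ : 0 < β) (hαβ : α + β < 1) {a b : ℝ} (ha : 0 < a) (hab : a ≤ b) :
    ∃ c : ℝ, 0 < c ∧ ∃ d₀ : ℕ, ∀ d : ℕ, d₀ ≤ d → ∀ σ : ℝ, 0 < σ → ∀ ε₀ : ℝ,
      a * (σ * (d : ℝ) ^ (1 / p) / Real.sqrt (Real.log d)) ≤ ε₀ →
      ε₀ ≤ b * (σ * (d : ℝ) ^ (1 / p) / Real.sqrt (Real.log d)) →
      ENNReal.ofReal (c * ε₀) ≤ criticalSeparation p α β σ ε₀ d := by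
  have hp0 : 0 < p := by linarith
  obtain ⟨η, ℓ₀, hη, hpriors⟩ := exists_priors hp hp_even ha (ha.trans_le hab)
  have hc : 1 < (1 + 2 * η) ^ (1 / p) := Real.one_lt_rpow (by linarith) (by positivity)
  obtain ⟨d₀, hd₀⟩ := Filter.eventually_atTop.1
    (eventually_error_lt (p := p) ha hη (sub_pos.2 hαβ) ℓ₀)
  refine ⟨(1 + 2 * η) ^ (1 / p) - 1, by linarith, d₀, fun d hd σ hσ ε₀ hε₀a hε₀b => ?_⟩
  obtain ⟨hℓ₀, hℓ, herr⟩ := hd₀ d hd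
  -- `Real.log 0 = 0`, so positivity of the logarithm excludes d = 0.
  have hdpos : 0 < d := Nat.pos_of_ne_zero fun h => by simp [h] at hℓ
  have hd0 : (0 : ℝ) < d := by exact_mod_cast hdpos
  set ℓ := Real.log d with hℓdef
  -- With this scale the radius rℓ is σ √(log d), while ε₀^p / d is of order r^p.
  set r := σ / Real.sqrt ℓ with hr
  have hsq : 0 < Real.sqrt ℓ := Real.sqrt_pos.2 hℓ
  have hr0 : 0 < r := by positivity
  have hrℓ : (r * ℓ) ^ 2 = σ ^ 2 * ℓ := by
    rw [hr, mul_pow, div_pow, Real.sq_sqrt hℓ.le]; field_simp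
  have hlevel : ∀ x : ℝ, x * (σ * (d : ℝ) ^ (1 / p) / Real.sqrt ℓ) = x * r * (d : ℝ) ^ (1 / p) :=
    fun x => by rw [hr]; ring
  have hpow : ∀ x : ℝ, 0 < x → (x * r * (d : ℝ) ^ (1 / p)) ^ p = d * (x * r) ^ p := fun x hx => by
    rw [Real.mul_rpow (by positivity) (by positivity), ← Real.rpow_mul hd0.le,
      one_div_mul_cancel hp0.ne', Real.rpow_one, mul_comm]
  rw [hlevel] at hε₀a hε₀b
  have hε₀ : 0 < ε₀ := lt_of_lt_of_le (by positivity) hε₀a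
  set t := ε₀ ^ p / d with ht
  have hdt : d * t = ε₀ ^ p := by rw [ht]; field_simp
  have hat : (a * r) ^ p ≤ t := by
    rw [ht, le_div_iff₀' hd0, ← hpow a ha]
    exact Real.rpow_le_rpow (by positivity) hε₀a hp0.le
  have htb : t ≤ (b * r) ^ p := by
    rw [ht, div_le_iff₀' hd0, ← hpow b (ha.trans_le hab)]
    exact Real.rpow_le_rpow hε₀.le hε₀b hp0.le
  have ht0 : 0 < t := by positivity
  obtain ⟨ν₀, ν₁, K, i₀, i₁, s₀, s₁, hK, hm, hmean₀, hmean₁⟩ :=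
    hpriors ℓ hℓ₀ r hr0 t hat htb
  have hηt : 0 < η * t := by positivity
  set err := (ℓ ^ p) ^ 2 / (d * (η * a ^ p) ^ 2) with herrdef
  have herr0 : 0 ≤ err := by positivity
  have herrle : ((r * ℓ) ^ p) ^ 2 / (d * (η * t) ^ 2) ≤ err := by
    calc ((r * ℓ) ^ p) ^ 2 / (d * (η * t) ^ 2)
        ≤ ((r * ℓ) ^ p) ^ 2 / (d * (η * (a * r) ^ p) ^ 2) := by gcongr
      _ = err := by
          rw [herrdef, Real.mul_rpow hr0.le hℓ.le, Real.mul_rpow ha.le hr0.le]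
          have : r ^ p ≠ 0 := by positivity
          field_simp
  -- Each threshold is ηt per coordinate away from the corresponding prior mean, (1 - η)t or at
  -- least (1 + 3η)t.
  set S₀ : Set (Fin d → ℝ) := {v | ∑ i, |v i| ^ p ≤ d * t} with hS₀
  set S₁ : Set (Fin d → ℝ) := {v | (1 + 2 * η) * (d * t) ≤ ∑ i, |v i| ^ p} with hS₁
  have hsum : Measurable fun v : Fin d → ℝ => ∑ i, |v i| ^ p := by fun_prop
  have hS₀m : MeasurableSet S₀ := measurableSet_le hsum measurable_const
  have hS₁m : MeasurableSet S₁ := measurableSet_le measurable_const hsum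
  have hS₀c : Measure.pi (fun _ : Fin d => ν₀) S₀ᶜ ≤ ENNReal.ofReal err := by
    refine (measure_mono fun v hv => ?_).trans ((pi_abs_sum_sub_ge_le hp0.le s₀ hdpos hηt).trans
      (ENNReal.ofReal_le_ofReal herrle))
    have hv' : d * t < ∑ i, |v i| ^ p := not_le.1 hv
    rw [Set.mem_ofPred_eq, hmean₀]
    refine le_trans ?_ (le_abs_self _)
    linarith
  have hS₁c : Measure.pi (fun _ : Fin d => ν₁) S₁ᶜ ≤ ENNReal.ofReal err := by
    refine (measure_mono fun v hv => ?_).trans ((pi_abs_sum_sub_ge_le hp0.le s₁ hdpos hηt).trans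
      (ENNReal.ofReal_le_ofReal herrle))
    have hv' : ∑ i, |v i| ^ p < (1 + 2 * η) * (d * t) := not_le.1 hv
    have := mul_le_mul_of_nonneg_left hmean₁ hd0.le
    rw [Set.mem_ofPred_eq]
    refine le_trans ?_ (neg_le_abs _)
    linarith
  have hδ : d * (4 * (1 / 2 : ℝ) ^ K * Real.exp (3 * (r * ℓ) ^ 2 / σ ^ 2)) ≤ 4 / d := by
    have h1 : 3 * (r * ℓ) ^ 2 / σ ^ 2 = 3 * ℓ := by rw [hrℓ]; field_simp
    have h2 : Real.exp ℓ = d := Real.exp_log hd0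
    calc _ ≤ d * (4 * Real.exp (-(5 * ℓ)) * Real.exp (3 * ℓ)) := by
          rw [h1]; gcongr; exact half_pow_le_exp hK
      _ = 4 / d := by
          rw [mul_assoc 4, ← Real.exp_add, show -(5 * ℓ) + 3 * ℓ = -(2 * ℓ) by ring, Real.exp_neg,
            show 2 * ℓ = ℓ + ℓ by ring, Real.exp_add, h2]
          field_simp
  refine le_iInf₂ fun ε₁ hε₁ => ENNReal.ofReal_le_ofReal ?_
  -- If ε₁ < (1 + 2η)^(1/p) ε₀, then all of S₁ lies in the alternative, and the two priors
  -- contradict the risk of the test.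
  by_contra! hlt
  obtain ⟨hε₁0, hrisk⟩ := hε₁
  obtain ⟨ψ, hψ, hψrisk⟩ : ∃ ψ : (Fin d → ℝ) → Bool, ∃ _ : IsValidTest p α σ ε₀ ψ,
      testRisk p σ ε₁ ψ < ENNReal.ofReal β := by simpa only [_root_.minimaxRisk, iInf_lt_iff] using hrisk
  have key := one_le_of_priors hψ.measurable hS₀m hS₁m (a := ENNReal.ofReal α)
    (b := ENNReal.ofReal β)
    (δ := ENNReal.ofReal (4 * (1 / 2) ^ K * Real.exp (3 * (r * ℓ) ^ 2 / σ ^ 2)))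
    (fun v hv => hψ.type_one_error v ((lpNormVec_le_iff hp0 v hε₀.le).2 (hdt ▸ hv)))
    (fun v hv => by
      refine le_trans ?_ hψrisk.le
      refine le_iSup₂_of_le (f := fun (v : Fin d → ℝ) (_ : ε₁ ≤ lpNormVec p v) =>
        gaussianSequence σ v {x | ψ x = false}) v ?_ le_rfl
      have h1 : (1 + 2 * η) ^ (1 / p) * ε₀ ≤ lpNormVec p v := by
        rw [le_lpNormVec_iff hp0 v (by positivity), Real.mul_rpow (by positivity) hε₀.le,
          ← Real.rpow_mul (by positivity), one_div_mul_cancel hp0.ne', Real.rpow_one, ← hdt]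
        exact hv
      linarith)
    (fun f hf hf1 => lintegral_gaussianMixture_le hσ s₁ s₀ (fun l h1 h2 => (hm l h1 h2).symm) hf hf1)
  refine absurd key (not_le.2 ?_)
  calc _ ≤ (ENNReal.ofReal α + ENNReal.ofReal err) + ENNReal.ofReal (4 / d) +
        (ENNReal.ofReal β + ENNReal.ofReal err) := by
        gcongr
        rw [← ENNReal.ofReal_natCast, ← ENNReal.ofReal_mul hd0.le]
        exact ENNReal.ofReal_le_ofReal hδ
    _ = ENNReal.ofReal (α + err + 4 / d + (β + err)) := by
        rw [← ENNReal.ofReal_add hα.le herr0, ← ENNReal.ofReal_add hβ.le herr0,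
          ← ENNReal.ofReal_add (by positivity) (by positivity),
          ← ENNReal.ofReal_add (by positivity) (by positivity)]
    _ < 1 := by
        rw [ENNReal.ofReal_lt_one]
        linarith

theorem mainTheorem11 (p : ℝ) (hp : 1 ≤ p) (hp_even : ∀ k : ℕ, p ≠ 2 * (k : ℝ)) :
    (∃ c C : ℝ, 0 < c ∧ 0 < C ∧ ∀ L : ℕ, 1 ≤ L →
      c * (L : ℝ) ^ (-p) ≤ momentMatchingGap p L ∧
      momentMatchingGap p L ≤ C * (L : ℝ) ^ (-p)) ∧
    (∃ c C : ℝ, 0 < c ∧ 0 < C ∧ ∀ L : ℕ, 1 ≤ L →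
      c / (L : ℝ) ≤ momentMatchingGap p L ^ (1 / p) ∧
      momentMatchingGap p L ^ (1 / p) ≤ C / (L : ℝ)) ∧
    (∀ α β : ℝ, 0 < α → 0 < β → α + β < 1 → ∀ a b : ℝ, 0 < a → a ≤ b →
      ∃ c : ℝ, 0 < c ∧ ∃ d₀ : ℕ, ∀ d : ℕ, d₀ ≤ d → ∀ σ : ℝ, 0 < σ → σ ≤ 1 →
        ∀ ε₀ : ℝ, a * (σ * (d : ℝ) ^ (1 / p) / Real.sqrt (Real.log d)) ≤ ε₀ →
          ε₀ ≤ b * (σ * (d : ℝ) ^ (1 / p) / Real.sqrt (Real.log d)) →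
          ENNReal.ofReal (c * ε₀) ≤ criticalSeparation p α β σ ε₀ d) := by
  have hp0 : 0 < p := by linarith
  obtain ⟨c, C, hc, hC, hbd⟩ := momentMatchingGap_bounds hp hp_even
  refine ⟨⟨c, C, hc, hC, hbd⟩, ⟨c ^ (1 / p), C ^ (1 / p), by positivity, by positivity,
    fun L hL => ?_⟩, fun α β hα hβ hαβ a b ha hab => ?_⟩
  · have hL0 : (0 : ℝ) < L := by exact_mod_cast hL
    have hroot : ∀ x : ℝ, 0 < x → (x * (L : ℝ) ^ (-p)) ^ (1 / p) = x ^ (1 / p) / L := fun x hx => by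
      rw [Real.mul_rpow hx.le (by positivity), ← Real.rpow_mul hL0.le, neg_mul,
        mul_one_div_cancel hp0.ne', Real.rpow_neg_one, ← div_eq_mul_inv]
    obtain ⟨h1, h2⟩ := hbd L hL
    have h0 : 0 < c * (L : ℝ) ^ (-p) := by positivity
    rw [← hroot c hc, ← hroot C hC]
    exact ⟨Real.rpow_le_rpow h0.le h1 (by positivity),
      Real.rpow_le_rpow (h0.le.trans h1) h2 (by positivity)⟩
  · obtain ⟨c, hc, d₀, h⟩ := ofReal_le_criticalSeparation hp hp_even hα hβ hαβ ha hab
    exact ⟨c, hc, d₀, fun d hd σ hσ _ => h d hd σ hσ⟩
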